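/- Let $G$ be a discrete group acting on a nonzero unital $C^*$-algebra $P$ by $*$-automorphisms, and let $H\subsetneq K\subsetneq G$ and $H\subsetneq L\subsetneq G$ be subgroups with $[G:H]<\infty$. For a subgroup $\Gamma\le G$ let $C_c(\Gamma,P)$ be the $*$-algebra of finite sums $\sum a_s s$ ($a_s\in P$, $s\in\Gamma$) with the twisted convolution product and involution, and let $P\rtimes\Gamma$ be its completion, either for all $\Gamma$ in the universal norm (the supremum of $\|\pi(x)\|$ over all $*$-representations $\pi$ of $C_c(\Gamma,P)$ on Hilbert spaces), or for all $\Gamma$ in the reduced norm (computed from a fixed faithful representation of $P$ on a Hilbert space). Put $A=P\rtimes G$. For $\Gamma\in\{H,K,L\}$ the inclusion $C_c(\Gamma,P)\subset C_c(G,P)$ extends to an injective $*$-homomorphism $P\rtimes\Gamma\to A$; let $B,C,D\subset A$ be the images of $P\rtimes H$, $P\rtimes K$, $P\rtimes L$. The map $\sum_{g\in G}a_g g\mapsto\sum_{h\in H}a_h h$ extends to a conditional expectation $E:A\to B$ of finite index, i.e. there are $\lambda_1,\dots,\lambda_n\in A$ with $x=\sum_i E(x\lambda_i)\lambda_i^*=\sum_i\lambda_iE(\lambda_i^*x)$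 for all $x\in A$; put $\mathrm{Ind}(E)=\sum_i\lambda_i\lambda_i^*$. Let $\mathrm{IMS}(B,A,E)$ be the set of $C^*$-algebras $B\subset Q\subset A$ that admit a conditional expectation $F_Q:A\to Q$ with $E|_Q\circ F_Q=E$. Let $e_B$ and $e_Q$ be the operators $x\mapsto E(x)$ and $x\mapsto F_Q(x)$ on the Hilbert $B$-module $A$ with $\langle x,y\rangle_B=E(x^*y)$, let $A_1=\mathrm{span}\{xe_By:x,y\in A\}$ be the $C^*$-basic construction, and let $E_1:A_1\to A$ be the dual conditional expectation, $E_1(xe_By)=\mathrm{Ind}(E)^{-1}xy$. The interior angle $\alpha(Q,R)\in[0,\pi/2]$ of $Q,R\in\mathrm{IMS}(B,A,E)\setminus\{B\}$ is defined by \[ \cos\alpha(Q,R)=\frac{\|E_1((e_Q-e_B)^*(e_R-e_B))\|}{\|E_1((e_Q-e_B)^*(e_Q-e_B))\|^{1/2}\,\|E_1((e_R-e_B)^*(e_R-e_B))\|^{1/2}}. \] Then $C,D\in\mathrm{IMS}(B,A,E)\setminus\{A,B\}$, the interior angle $\alpha(C,D)$ is well defined, and \[ \cos\alpha(C,D)=\frac{[K\cap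 L:H]-1}{\sqrt{[K:H]-1}\,\sqrt{[L:H]-1}}. \] -/

import Mathlib

set_option linter.unusedSectionVars false

noncomputable section

/-! ### C*-seminorms and the associated completions -/

/-- A C*-seminorm on a unital complex *-algebra. -/
structure CStarSeminorm (R : Type*) [Ring R] [StarRing R] [Algebra ℂ R] extends
    Seminorm ℂ R where
  mul_le : ∀ x y, toFun (x * y) ≤ toFun x * toFun y
  star_mul_self : ∀ x, toFun (star x * x) = toFun x * toFun x

namespace CStarSeminorm

variable {R : Type*} [Ring R] [StarRing R] [Algebra ℂ R]

/-- The *-algebra `R`, viewed as a seminormed algebra through `p`. -/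
def Carrier (_p : CStarSeminorm R) : Type _ := R

variable (p : CStarSeminorm R)

instance : Ring p.Carrier := inferInstanceAs (Ring R)
instance : StarRing p.Carrier := inferInstanceAs (StarRing R)
instance : Algebra ℂ p.Carrier := inferInstanceAs (Algebra ℂ R)
instance [StarModule ℂ R] : StarModule ℂ p.Carrier := inferInstanceAs (StarModule ℂ R)

/-- The tautological identification of `R` with `p.Carrier`. -/
def toCarrier : R ≃⋆ₐ[ℂ] p.Carrier := StarAlgEquiv.refl ℂ R

/-- `p`, as a group seminorm on `p.Carrier`. -/
def groupSeminorm : AddGroupSeminorm p.Carrier where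
  toFun x := p.toFun x
  map_zero' := map_zero p.toSeminorm
  add_le' := p.add_le'
  neg' := p.neg'

instance : SeminormedRing p.Carrier where
  __ : Ring p.Carrier := inferInstance
  __ : SeminormedAddCommGroup p.Carrier := p.groupSeminorm.toSeminormedAddCommGroup
  norm_mul_le := p.mul_le

theorem norm_toCarrier (x : R) : ‖p.toCarrier x‖ = p.toSeminorm x := rfl

instance : NormedAlgebra ℂ p.Carrier where
  __ : Algebra ℂ p.Carrier := inferInstance
  norm_smul_le c x := (p.toSeminorm.smul' c (p.toCarrier.symm x)).le

theorem norm_star_mul_self (x : p.Carrier) : ‖star x * x‖ = ‖x‖ * ‖x‖ := p.star_mul_self x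

theorem norm_le_norm_star (x : p.Carrier) : ‖x‖ ≤ ‖star x‖ := by
  rcases (norm_nonneg x).eq_or_lt' with h | h
  · rw [h]; exact norm_nonneg _
  · have := norm_mul_le (star x) x
    rw [norm_star_mul_self] at this
    exact le_of_mul_le_mul_right this h

theorem norm_star (x : p.Carrier) : ‖star x‖ = ‖x‖ :=
  le_antisymm (by simpa using p.norm_le_norm_star (star x)) (p.norm_le_norm_star x)

theorem uniformContinuous_star : UniformContinuous (star : p.Carrier → p.Carrier) :=
  (AddMonoidHomClass.isometry_of_norm (starAddEquiv (R := p.Carrier)) p.norm_star).uniformContinuous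

/-- The completion of `R` with respect to the C*-seminorm `p`. -/
abbrev Compl : Type _ := UniformSpace.Completion p.Carrier

open UniformSpace

instance : Star p.Compl where
  star := Completion.map star

theorem coe_star (x : p.Carrier) : ((star x : p.Carrier) : p.Compl) = star (x : p.Compl) :=
  (Completion.map_coe p.uniformContinuous_star x).symm

theorem continuous_star : Continuous (star : p.Compl → p.Compl) := Completion.continuous_map

instance : StarRing p.Compl where
  star_involutive x := by
    induction x using Completion.induction_on with
    | hp => exact isClosed_eq (p.continuous_star.comp p.continuous_star) continuous_id
    | ih x => rw [← coe_star, ← coe_star, star_star]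
  star_mul x y := by
    induction x, y using Completion.induction_on₂ with
    | hp =>
      exact isClosed_eq (p.continuous_star.comp (by fun_prop))
        ((p.continuous_star.comp continuous_snd).mul (p.continuous_star.comp continuous_fst))
    | ih x y => rw [← Completion.coe_mul, ← coe_star, ← coe_star, ← coe_star, star_mul,
        Completion.coe_mul]
  star_add x y := by
    induction x, y using Completion.induction_on₂ with
    | hp =>
      exact isClosed_eq (p.continuous_star.comp (by fun_prop))
        ((p.continuous_star.comp continuous_fst).add (p.continuous_star.comp continuous_snd))
    | ih x y => rw [← Completion.coe_add, ← coe_star, ← coe_star, ← coe_star, star_add,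
        Completion.coe_add]

instance : CStarRing p.Compl where
  norm_mul_self_le x := by
    induction x using Completion.induction_on with
    | hp =>
      exact isClosed_le (by fun_prop) ((p.continuous_star.mul continuous_id).norm)
    | ih x => rw [← coe_star, ← Completion.coe_mul, Completion.norm_coe, Completion.norm_coe,
        p.norm_star_mul_self]

instance [StarModule ℂ R] : StarModule ℂ p.Compl where
  star_smul c x := by
    induction x using Completion.induction_on with
    | hp => exact isClosed_eq (p.continuous_star.comp (continuous_const_smul c))
              ((continuous_const_smul (star c)).comp p.continuous_star)
    | ih x => rw [← Completion.coe_smul, ← coe_star, ← coe_star, star_smul, Completion.coe_smul]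

instance [StarModule ℂ R] : CStarAlgebra p.Compl where
  __ : NormedRing p.Compl := inferInstance
  __ : StarRing p.Compl := inferInstance
  __ : CStarRing p.Compl := inferInstance
  __ : CompleteSpace p.Compl := inferInstance
  __ : Algebra ℂ p.Compl := inferInstance
  __ : StarModule ℂ p.Compl := inferInstance
  norm_smul_le c x := norm_smul_le c x

/-- The canonical *-homomorphism of `R` into its completion. -/
def toCompl : R →⋆ₐ[ℂ] p.Compl where
  toFun x := (p.toCarrier x : p.Compl)
  map_one' := by rw [map_one, Completion.coe_one]
  map_mul' x y := by rw [map_mul, Completion.coe_mul]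
  map_zero' := by rw [map_zero, Completion.coe_zero]
  map_add' x y := by rw [map_add, Completion.coe_add]
  commutes' r := by
    rw [Algebra.algebraMap_eq_smul_one, Algebra.algebraMap_eq_smul_one, map_smul, map_one,
      Completion.coe_smul, Completion.coe_one]
  map_star' x := by rw [map_star, coe_star]

theorem norm_toCompl (x : R) : ‖p.toCompl x‖ = p.toSeminorm x :=
  (Completion.norm_coe _).trans (p.norm_toCarrier x)

theorem denseRange_toCompl : DenseRange p.toCompl :=
  Completion.denseRange_coe (α := p.Carrier)

/-- The C*-seminorm `x ↦ ‖π x‖` attached to a *-homomorphism into a C*-algebra. -/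
def ofHom {C : Type*} [NonUnitalCStarAlgebra C] (π : R →⋆ₙₐ[ℂ] C) : CStarSeminorm R where
  toFun x := ‖π x‖
  map_zero' := by simp
  add_le' x y := by rw [map_add]; exact norm_add_le _ _
  neg' x := by rw [map_neg, norm_neg]
  smul' c x := by rw [map_smul, norm_smul]
  mul_le x y := by rw [map_mul]; exact norm_mul_le _ _
  star_mul_self x := by rw [map_mul, map_star, CStarRing.norm_star_mul_self]

end CStarSeminorm

/-! ### The *-algebra `C_c(G, P)` -/

/-- `G` acts on the C*-algebra `P` by *-automorphisms: the action by ring automorphisms is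
complex linear and commutes with the involution. -/
class StarAction (G P : Type*) [Group G] [CStarAlgebra P] [MulSemiringAction G P] : Prop extends
    SMulCommClass G ℂ P where
  smul_star : ∀ (g : G) (a : P), g • star a = star (g • a)

instance StarAction.subgroup {G P : Type*} [Group G] [CStarAlgebra P] [MulSemiringAction G P]
    [StarAction G P] (K : Subgroup G) : StarAction K P where
  smul_comm k c a := smul_comm (k : G) c a
  smul_star k a := StarAction.smul_star (k : G) a

theorem StarAction.norm_smul_le {G P : Type*} [Group G] [CStarAlgebra P] [MulSemiringAction G P]
    [StarAction G P] (g : G) (a : P) : ‖g • a‖ ≤ ‖a‖ :=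
  NonUnitalStarAlgHom.norm_apply_le
    ({ toFun := fun a => g • a
       map_smul' := fun c a => smul_comm g c a
       map_zero' := smul_zero g
       map_add' := smul_add g
       map_mul' := smul_mul' g
       map_star' := StarAction.smul_star g } : P →⋆ₙₐ[ℂ] P) a

namespace SkewMonoidAlgebra

variable {G P : Type*} [Group G] [CStarAlgebra P] [MulSemiringAction G P] [StarAction G P]

/-- The involution `(∑ a_s s)^* = ∑ α_{s⁻¹}(a_s^*) s⁻¹`. -/
instance : Star (SkewMonoidAlgebra P G) where
  star x := x.sum fun s a => single s⁻¹ (s⁻¹ • star a)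

theorem star_single (s : G) (a : P) :
    star (single s a : SkewMonoidAlgebra P G) = single s⁻¹ (s⁻¹ • star a) :=
  sum_single_index (by simp)

theorem star_add_aux (x y : SkewMonoidAlgebra P G) : star (x + y) = star x + star y :=
  sum_add_index' (by simp) (by simp [smul_add, single_add])

instance : StarRing (SkewMonoidAlgebra P G) where
  star_involutive x := by
    induction x using induction_on with
    | zero => simp [star, sum_zero_index]
    | single s a => simp [star_single, StarAction.smul_star]
    | add x y hx hy => rw [star_add_aux, star_add_aux, hx, hy]
  star_add := star_add_aux
  star_mul x y := by
    induction x using induction_on with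
    | zero => simp [star, sum_zero_index]
    | single s a =>
      induction y using induction_on with
      | zero => simp [star, sum_zero_index]
      | single t b =>
        simp [star_single, single_mul_single, StarAction.smul_star, mul_smul]
      | add x y hx hy => rw [mul_add, star_add_aux, star_add_aux, hx, hy, add_mul]
    | add x z hx hz => rw [add_mul, star_add_aux, star_add_aux, hx, hz, mul_add]

instance : StarModule ℂ (SkewMonoidAlgebra P G) where
  star_smul c x := by
    induction x using induction_on with
    | zero => simp
    | single s a => simp [star_single, smul_single, smul_comm]
    | add x y hx hy => rw [smul_add, star_add, hx, hy, star_add, smul_add]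

end SkewMonoidAlgebra

open SkewMonoidAlgebra

/-- The canonical inclusion `C_c(K, P) → C_c(G, P)` for a subgroup `K` of `G`. -/
def ccIncl {G P : Type*} [Group G] [CStarAlgebra P] (K : Subgroup G)
    (x : SkewMonoidAlgebra P K) : SkewMonoidAlgebra P G :=
  mapDomain K.subtype x

/-- The canonical projection `C_c(G, P) → C_c(K, P)`, `∑ a_g g ↦ ∑_{k ∈ K} a_k k`. -/
def ccRestrict {G P : Type*} [Group G] [CStarAlgebra P] (K : Subgroup G)
    (x : SkewMonoidAlgebra P G) : SkewMonoidAlgebra P K :=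
  ⟨x.coeff.subtypeDomain (· ∈ K)⟩

/-! ### The reduced norm -/

section Reduced

variable {G P : Type*} [Group G] [CStarAlgebra P] [MulSemiringAction G P] [StarAction G P]
variable {𝓗 : Type*} [NormedAddCommGroup 𝓗] [InnerProductSpace ℂ 𝓗] [CompleteSpace 𝓗]

/-- The Hilbert space `𝓗 ⊗ ℓ²(G)`, realized as `ℓ²(G, 𝓗)`. -/
abbrev HilbertTensor (G 𝓗 : Type*) [NormedAddCommGroup 𝓗] : Type _ := lp (fun _ : G => 𝓗) 2

theorem norm_rep_smul_le (ρ : P →⋆ₐ[ℂ] (𝓗 →L[ℂ] 𝓗)) (g : G) (a : P) (v : 𝓗) :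
    ‖ρ (g • a) v‖ ≤ ‖a‖ * ‖v‖ :=
  (ContinuousLinearMap.le_opNorm _ _).trans <| by
    gcongr
    exact (NonUnitalStarAlgHom.norm_apply_le ρ _).trans (StarAction.norm_smul_le g a)

theorem hasSum_sq_norm (ξ : HilbertTensor G 𝓗) : HasSum (fun t => ‖ξ t‖ ^ 2) (‖ξ‖ ^ 2) := by
  have := lp.hasSum_norm (p := 2) (by norm_num) ξ
  simpa using this

theorem memℓp_regularFun (ρ : P →⋆ₐ[ℂ] (𝓗 →L[ℂ] 𝓗)) (s : G) (a : P) (ξ : HilbertTensor G 𝓗) :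
    Memℓp (fun t : G => ρ (t⁻¹ • a) (ξ (s⁻¹ * t))) 2 := by
  apply memℓp_gen
  have h1 : Summable fun t => ‖a‖ ^ 2 * ‖ξ (s⁻¹ * t)‖ ^ 2 :=
    (((Equiv.mulLeft s⁻¹).summable_iff).2 (hasSum_sq_norm ξ).summable).mul_left _
  refine Summable.of_nonneg_of_le (fun t => by positivity) (fun t => ?_) h1
  rw [← mul_pow]
  simp only [ENNReal.toReal_ofNat, Real.rpow_ofNat]
  gcongr
  exact norm_rep_smul_le ρ _ _ _

/-- The operator `π(a)(1 ⊗ λ_s)` on `𝓗 ⊗ ℓ²(G)`; it maps `ξ ⊗ δ_t` to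
`ρ(α_{(st)⁻¹}(a)) ξ ⊗ δ_{st}`. -/
def regularOp (ρ : P →⋆ₐ[ℂ] (𝓗 →L[ℂ] 𝓗)) (s : G) (a : P) :
    HilbertTensor G 𝓗 →L[ℂ] HilbertTensor G 𝓗 :=
  LinearMap.mkContinuous
    { toFun := fun ξ => ⟨fun t => ρ (t⁻¹ • a) (ξ (s⁻¹ * t)), memℓp_regularFun ρ s a ξ⟩
      map_add' := fun ξ η => by ext t; simp; rfl
      map_smul' := fun c ξ => by ext t; simp }
    ‖a‖ (fun ξ => by
      have h1 := ((Equiv.mulLeft s⁻¹).hasSum_iff (f := fun t => ‖ξ t‖ ^ 2)).2 (hasSum_sq_norm ξ)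
      refine (sq_le_sq₀ (norm_nonneg _) (by positivity)).1 ?_
      rw [mul_pow]
      refine hasSum_le (fun t => ?_) (hasSum_sq_norm _) (h1.mul_left (‖a‖ ^ 2))
      simp only [Function.comp, Equiv.coe_mulLeft, ← mul_pow]
      gcongr
      exact norm_rep_smul_le ρ _ _ _)

theorem regularOp_apply (ρ : P →⋆ₐ[ℂ] (𝓗 →L[ℂ] 𝓗)) (s : G) (a : P) (ξ : HilbertTensor G 𝓗)
    (t : G) : regularOp ρ s a ξ t = ρ (t⁻¹ • a) (ξ (s⁻¹ * t)) := rfl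

theorem regularOp_zero (ρ : P →⋆ₐ[ℂ] (𝓗 →L[ℂ] 𝓗)) (s : G) : regularOp ρ s (0 : P) = 0 := by
  ext ξ t; simp [regularOp_apply]

theorem regularOp_add (ρ : P →⋆ₐ[ℂ] (𝓗 →L[ℂ] 𝓗)) (s : G) (a b : P) :
    regularOp ρ s (a + b) = regularOp ρ s a + regularOp ρ s b := by
  ext ξ t; simp [regularOp_apply]

theorem regularOp_smul (ρ : P →⋆ₐ[ℂ] (𝓗 →L[ℂ] 𝓗)) (s : G) (c : ℂ) (a : P) :
    regularOp ρ s (c • a) = c • regularOp ρ s a := by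
  ext ξ t; simp [regularOp_apply, smul_comm]

theorem regularOp_mul (ρ : P →⋆ₐ[ℂ] (𝓗 →L[ℂ] 𝓗)) (s t : G) (a b : P) :
    regularOp ρ (s * t) (a * s • b) = regularOp ρ s a * regularOp ρ t b := by
  ext ξ r; simp [regularOp_apply, mul_assoc, mul_smul]

theorem regularOp_star (ρ : P →⋆ₐ[ℂ] (𝓗 →L[ℂ] 𝓗)) (s : G) (a : P) :
    regularOp ρ s⁻¹ (s⁻¹ • star a) = star (regularOp ρ s a) := by
  rw [ContinuousLinearMap.star_eq_adjoint, ContinuousLinearMap.eq_adjoint_iff]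
  intro ξ η
  rw [lp.inner_eq_tsum, lp.inner_eq_tsum,
    ← (Equiv.mulLeft s).tsum_eq (fun t => inner ℂ (ξ t) (regularOp ρ s a η t))]
  refine tsum_congr fun t => ?_
  rw [Equiv.coe_mulLeft, regularOp_apply, regularOp_apply, inv_inv, inv_mul_cancel_left, ← mul_smul,
    ← mul_inv_rev, StarAction.smul_star, map_star, ContinuousLinearMap.star_eq_adjoint,
    ContinuousLinearMap.adjoint_inner_left]

/-- The additive map underlying `regularRep`. -/
def regularSum (ρ : P →⋆ₐ[ℂ] (𝓗 →L[ℂ] 𝓗)) (x : SkewMonoidAlgebra P G) :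
    HilbertTensor G 𝓗 →L[ℂ] HilbertTensor G 𝓗 :=
  x.sum fun s a => regularOp ρ s a

theorem regularSum_zero (ρ : P →⋆ₐ[ℂ] (𝓗 →L[ℂ] 𝓗)) :
    regularSum ρ (0 : SkewMonoidAlgebra P G) = 0 := sum_zero_index

theorem regularSum_single (ρ : P →⋆ₐ[ℂ] (𝓗 →L[ℂ] 𝓗)) (s : G) (a : P) :
    regularSum ρ (single s a) = regularOp ρ s a := sum_single_index (regularOp_zero ρ s)

theorem regularSum_add (ρ : P →⋆ₐ[ℂ] (𝓗 →L[ℂ] 𝓗)) (x y : SkewMonoidAlgebra P G) :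
    regularSum ρ (x + y) = regularSum ρ x + regularSum ρ y :=
  sum_add_index' (regularOp_zero ρ) (regularOp_add ρ)

/-- The representation `∑ a_s s ↦ ∑ π(a_s)(1 ⊗ λ_s)` of `C_c(G, P)` on `𝓗 ⊗ ℓ²(G)` induced by a
representation `ρ` of `P` on `𝓗`. -/
def regularRep (ρ : P →⋆ₐ[ℂ] (𝓗 →L[ℂ] 𝓗)) :
    SkewMonoidAlgebra P G →⋆ₙₐ[ℂ] (HilbertTensor G 𝓗 →L[ℂ] HilbertTensor G 𝓗) where
  toFun := regularSum ρ
  map_zero' := regularSum_zero ρ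
  map_add' := regularSum_add ρ
  map_smul' c x := by
    induction x using induction_on with
    | zero => simp [regularSum_zero]
    | single s a => simp [smul_single, regularSum_single, regularOp_smul]
    | add x y hx hy => rw [smul_add, regularSum_add, hx, hy, regularSum_add, smul_add]
  map_mul' x y := by
    induction x using induction_on with
    | zero => simp [regularSum_zero]
    | single s a =>
      induction y using induction_on with
      | zero => simp [regularSum_zero]
      | single t b => simp only [single_mul_single, regularSum_single, regularOp_mul]
      | add x y hx hy => rw [mul_add, regularSum_add, hx, hy, regularSum_add, mul_add]
    | add x z hx hz => rw [add_mul, regularSum_add, hx, hz, regularSum_add, add_mul]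
  map_star' x := by
    induction x using induction_on with
    | zero => simp [regularSum_zero]
    | single s a => simp only [star_single, regularSum_single, regularOp_star]
    | add x y hx hy => rw [star_add, regularSum_add, hx, hy, regularSum_add, star_add]

/-- The reduced norm on `C_c(G, P)`, computed from the representation `ρ` of `P`. -/
def reducedNorm (ρ : P →⋆ₐ[ℂ] (𝓗 →L[ℂ] 𝓗)) : CStarSeminorm (SkewMonoidAlgebra P G) :=
  CStarSeminorm.ofHom (regularRep ρ)

end Reduced

/-! ### The universal norm -/

section Universal

universe u v

variable {G : Type v} {P : Type u} [Group G] [CStarAlgebra P] [MulSemiringAction G P]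
  [StarAction G P]

/-- The set of all values `‖π(x)‖`, where `π` runs over the *-homomorphisms of `C_c(G, P)` into
`B(𝓗)`, for Hilbert spaces `𝓗`. Every cyclic representation of `C_c(G, P)` lives (up to unitary
equivalence) on a Hilbert space in the universe `max u v`. -/
def repNorms (x : SkewMonoidAlgebra P G) : Set ℝ :=
  {r | ∃ (𝓗 : Type (max u v)) (_ : NormedAddCommGroup 𝓗) (_ : InnerProductSpace ℂ 𝓗)
    (_ : CompleteSpace 𝓗) (π : SkewMonoidAlgebra P G →⋆ₙₐ[ℂ] (𝓗 →L[ℂ] 𝓗)), r = ‖π x‖}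

theorem repNorms_nonempty (x : SkewMonoidAlgebra P G) : (repNorms x).Nonempty :=
  ⟨_, PUnit, inferInstance, inferInstance, inferInstance, 0, rfl⟩

theorem repNorms_nonneg {x : SkewMonoidAlgebra P G} {r : ℝ} (hr : r ∈ repNorms x) : 0 ≤ r := by
  obtain ⟨𝓗, _, _, _, π, rfl⟩ := hr
  exact norm_nonneg _

theorem norm_rep_single_le {C : Type*} [NonUnitalCStarAlgebra C]
    (π : SkewMonoidAlgebra P G →⋆ₙₐ[ℂ] C) (s : G) (a : P) : ‖π (single s a)‖ ≤ ‖a‖ := by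
  have h1 : ∀ b : P, ‖π (single 1 b)‖ ≤ ‖b‖ := fun b =>
    NonUnitalStarAlgHom.norm_apply_le
      ({ toFun := fun a => π (single 1 a)
         map_smul' := fun c a => by simp [← smul_single]
         map_zero' := by simp
         map_add' := fun a b => by simp [single_add]
         map_mul' := fun a b => by simp [← map_mul, single_mul_single]
         map_star' := fun a => by simp [← map_star, star_single] } : P →⋆ₙₐ[ℂ] C) b
  refine (sq_le_sq₀ (norm_nonneg _) (norm_nonneg _)).1 ?_
  have h2 : star (single s a : SkewMonoidAlgebra P G) * single s a
      = single 1 (s⁻¹ • (star a * a)) := by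
    simp [star_single, single_mul_single, smul_mul']
  rw [sq, ← CStarRing.norm_star_mul_self, ← map_star, ← map_mul, h2, sq,
    ← CStarRing.norm_star_mul_self (x := a)]
  exact (h1 _).trans (StarAction.norm_smul_le _ _)

theorem repNorms_bddAbove (x : SkewMonoidAlgebra P G) : BddAbove (repNorms x) := by
  refine ⟨x.coeff.sum fun _ a => ‖a‖, ?_⟩
  rintro _ ⟨𝓗, _, _, _, π, rfl⟩
  conv_lhs => rw [← sum_single x, sum_def, Finsupp.sum, _root_.map_sum]
  exact (norm_sum_le _ _).trans (Finset.sum_le_sum fun s _ => norm_rep_single_le π s _)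

theorem norm_rep_le_sSup {x : SkewMonoidAlgebra P G} {𝓗 : Type (max u v)} [NormedAddCommGroup 𝓗]
    [InnerProductSpace ℂ 𝓗] [CompleteSpace 𝓗]
    (π : SkewMonoidAlgebra P G →⋆ₙₐ[ℂ] (𝓗 →L[ℂ] 𝓗)) : ‖π x‖ ≤ sSup (repNorms x) :=
  le_csSup (repNorms_bddAbove x) ⟨𝓗, _, _, _, π, rfl⟩

theorem sSup_repNorms_nonneg (x : SkewMonoidAlgebra P G) : 0 ≤ sSup (repNorms x) :=
  Real.sSup_nonneg fun _ h => repNorms_nonneg h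

/-- The universal norm `‖x‖ = sup_π ‖π(x)‖` on `C_c(G, P)`. -/
def universalNorm : CStarSeminorm (SkewMonoidAlgebra P G) where
  __ := Seminorm.ofSMulLE (𝕜 := ℂ) (fun x : SkewMonoidAlgebra P G => sSup (repNorms x))
    (by
      refine le_antisymm (csSup_le (repNorms_nonempty _) fun r hr => ?_) (sSup_repNorms_nonneg _)
      obtain ⟨𝓗, _, _, _, π, rfl⟩ := hr
      simp)
    (fun x y => by
      refine csSup_le (repNorms_nonempty _) ?_
      rintro _ ⟨𝓗, _, _, _, π, rfl⟩
      rw [map_add]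
      exact (norm_add_le _ _).trans (add_le_add (norm_rep_le_sSup π) (norm_rep_le_sSup π)))
    (fun c x => by
      refine csSup_le (repNorms_nonempty _) ?_
      rintro _ ⟨𝓗, _, _, _, π, rfl⟩
      rw [map_smul, norm_smul]
      gcongr
      exact norm_rep_le_sSup π)
  mul_le x y := by
    refine csSup_le (repNorms_nonempty _) ?_
    rintro _ ⟨𝓗, _, _, _, π, rfl⟩
    rw [map_mul]
    exact (norm_mul_le _ _).trans (mul_le_mul (norm_rep_le_sSup π) (norm_rep_le_sSup π)
      (norm_nonneg _) (sSup_repNorms_nonneg _))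
  star_mul_self x := by
    refine le_antisymm (csSup_le (repNorms_nonempty _) ?_) ?_
    · rintro _ ⟨𝓗, _, _, _, π, rfl⟩
      rw [map_mul, map_star, CStarRing.norm_star_mul_self]
      exact mul_le_mul (norm_rep_le_sSup π) (norm_rep_le_sSup π)
        (norm_nonneg _) (sSup_repNorms_nonneg _)
    · change sSup (repNorms x) * sSup (repNorms x) ≤ sSup (repNorms (star x * x))
      have h : sSup (repNorms x) ≤ √(sSup (repNorms (star x * x))) := by
        refine csSup_le (repNorms_nonempty _) ?_
        rintro _ ⟨𝓗, _, _, _, π, rfl⟩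
        refine Real.le_sqrt_of_sq_le ?_
        rw [sq, ← CStarRing.norm_star_mul_self, ← map_star, ← map_mul]
        exact norm_rep_le_sSup π
      calc _ ≤ √(sSup (repNorms (star x * x))) * √(sSup (repNorms (star x * x))) :=
            mul_le_mul h h (sSup_repNorms_nonneg _) (Real.sqrt_nonneg _)
        _ = _ := Real.mul_self_sqrt (sSup_repNorms_nonneg _)

end Universal

/-! ### Crossed products -/

section CrossedProduct

universe u v w

/-- The two kinds of crossed products with coefficient algebra `P`: the universal one, and the
reduced one, which is computed from a faithful representation `ρ` of `P` on a Hilbert space. -/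
inductive CrossedKind (P : Type u) [CStarAlgebra P] : Type (max u (w + 1))
  | universal : CrossedKind P
  | reduced (𝓗 : Type w) [NormedAddCommGroup 𝓗] [InnerProductSpace ℂ 𝓗] [CompleteSpace 𝓗]
      (ρ : P →⋆ₐ[ℂ] (𝓗 →L[ℂ] 𝓗)) (hρ : Function.Injective ρ) : CrossedKind P

variable {P : Type u} [CStarAlgebra P]

/-- The reduced or universal norm on `C_c(G, P)`. -/
def CrossedKind.norm (κ : CrossedKind.{u, w} P) (G : Type v) [Group G] [MulSemiringAction G P]
    [StarAction G P] : CStarSeminorm (SkewMonoidAlgebra P G) :=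
  match κ with
  | .universal => universalNorm
  | @CrossedKind.reduced _ _ _ _ _ _ ρ _ => reducedNorm ρ

/-- The reduced or universal crossed product of `P` by `G`: the completion of `C_c(G, P)` in the
reduced or universal norm. -/
abbrev CrossedKind.Product (κ : CrossedKind.{u, w} P) (G : Type v) [Group G]
    [MulSemiringAction G P] [StarAction G P] : Type (max u v) :=
  (κ.norm G).Compl

/-- The canonical map of `C_c(G, P)` into the crossed product. -/
abbrev CrossedKind.of (κ : CrossedKind.{u, w} P) (G : Type v) [Group G]
    [MulSemiringAction G P] [StarAction G P] : SkewMonoidAlgebra P G →⋆ₐ[ℂ] κ.Product G :=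
  (κ.norm G).toCompl

/-- `j` is the canonical embedding of the crossed product by the subgroup `K` into the crossed
product by `G`: the injective *-homomorphism that extends `C_c(K, P) ⊆ C_c(G, P)`. -/
def CrossedKind.IsEmbedding (κ : CrossedKind.{u, w} P) {G : Type v} [Group G]
    [MulSemiringAction G P] [StarAction G P] (K : Subgroup G)
    (j : κ.Product K →⋆ₐ[ℂ] κ.Product G) : Prop :=
  Function.Injective j ∧ ∀ x : SkewMonoidAlgebra P K, j (κ.of K x) = κ.of G (ccIncl K x)

end CrossedProduct

/-! ### Conditional expectations of finite index -/

section Watatani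

variable {A : Type*} [CStarAlgebra A]

/-- `E` is a conditional expectation of `A` onto the C*-subalgebra `B`: a positive `B`-bimodule
projection of `A` onto `B`. It is written as a linear map of `A` into itself with values in `B`. -/
structure IsCondExp (B : StarSubalgebra ℂ A) (E : A →ₗ[ℂ] A) : Prop where
  mem : ∀ a, E a ∈ B
  map_of_mem : ∀ b ∈ B, E b = b
  map_mul_left : ∀ b ∈ B, ∀ a, E (b * a) = b * E a
  map_mul_right : ∀ b ∈ B, ∀ a, E (a * b) = E a * b
  positive : ∀ a, ∃ c, E (star a * a) = star c * c

/-- `l` is a quasi-basis of `E`. -/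
def IsQuasiBasis (E : A →ₗ[ℂ] A) {n : ℕ} (l : Fin n → A) : Prop :=
  ∀ x, x = ∑ i, E (x * l i) * star (l i) ∧ x = ∑ i, l i * E (star (l i) * x)

/-- `E` has finite index. -/
def HasFiniteIndex (E : A →ₗ[ℂ] A) : Prop :=
  ∃ (n : ℕ) (l : Fin n → A), IsQuasiBasis E l

open Classical in
/-- A chosen quasi-basis of `E` (the empty family if there is none). -/
def quasiBasis (E : A →ₗ[ℂ] A) : Σ n : ℕ, Fin n → A :=
  if h : HasFiniteIndex E then ⟨h.choose, h.choose_spec.choose⟩ else ⟨0, fun _ => 0⟩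

theorem isQuasiBasis_quasiBasis {E : A →ₗ[ℂ] A} (h : HasFiniteIndex E) :
    IsQuasiBasis E (quasiBasis E).2 := by
  rw [quasiBasis, dif_pos h]
  exact h.choose_spec.choose_spec

/-- The Watatani index `Ind(E) = ∑ λ_i λ_i^*`. -/
def watataniIndex (E : A →ₗ[ℂ] A) : A :=
  ∑ i, (quasiBasis E).2 i * star ((quasiBasis E).2 i)

/-- The index does not depend on the quasi-basis. -/
theorem watataniIndex_eq {E : A →ₗ[ℂ] A} {n : ℕ} {l : Fin n → A} (hl : IsQuasiBasis E l) :
    watataniIndex E = ∑ i, l i * star (l i) := by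
  have h := isQuasiBasis_quasiBasis ⟨n, l, hl⟩
  calc watataniIndex E
      = ∑ i, (∑ j, l j * E (star (l j) * (quasiBasis E).2 i)) * star ((quasiBasis E).2 i) :=
        Finset.sum_congr rfl fun i _ => by rw [← (hl _).2]
    _ = ∑ j, l j * ∑ i, E (star (l j) * (quasiBasis E).2 i) * star ((quasiBasis E).2 i) := by
        simp only [Finset.sum_mul, Finset.mul_sum, mul_assoc]
        exact Finset.sum_comm
    _ = ∑ j, l j * star (l j) := Finset.sum_congr rfl fun j _ => by rw [← (h _).1]

/-! ### Intermediate subalgebras -/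

/-- `F` is a conditional expectation of `A` onto `C` that is compatible with `E`, that is,
`E = E|_C ∘ F`. -/
def IsCompatibleExp (E : A →ₗ[ℂ] A) (C : StarSubalgebra ℂ A) (F : A →ₗ[ℂ] A) : Prop :=
  IsCondExp C F ∧ ∀ a, E (F a) = E a

/-- The set `IMS(B, A, E)` of the C*-subalgebras `B ⊆ C ⊆ A` that admit a conditional expectation
compatible with `E`. -/
def IMS (B : StarSubalgebra ℂ A) (E : A →ₗ[ℂ] A) : Set (StarSubalgebra ℂ A) :=
  {C | IsClosed (C : Set A) ∧ B ≤ C ∧ ∃ F, IsCompatibleExp E C F}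

/-! ### The basic construction

For `E` of finite index, `A` is complete in the norm `‖E(x^* x)‖^{1/2}`, so that `A` itself is the
Hilbert `B`-module with the inner product `⟨x, y⟩_B = E(x^* y)`. The operators on it are linear
maps of `A` into itself; `A` acts by left multiplication, and the Jones projection of a
conditional expectation `F` is the operator `x ↦ F(x)`, that is, `F` itself. -/

/-- `S` is an adjoint of `T` for the `B`-valued inner product `⟨x, y⟩_B = E(x^* y)`. -/
def IsAdjointFor (E : A →ₗ[ℂ] A) (T S : Module.End ℂ A) : Prop :=
  ∀ x y, E (star (T x) * y) = E (star x * S y)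

open Classical in
/-- The adjoint of an adjointable operator `T` (zero if `T` is not adjointable). -/
def moduleAdjoint (E : A →ₗ[ℂ] A) (T : Module.End ℂ A) : Module.End ℂ A :=
  if h : ∃ S, IsAdjointFor E T S then h.choose else 0

/-- Adjoints are unique. -/
theorem moduleAdjoint_eq {E : A →ₗ[ℂ] A} (hE : HasFiniteIndex E) {T S : Module.End ℂ A}
    (h : IsAdjointFor E T S) : moduleAdjoint E T = S := by
  have hex : ∃ S, IsAdjointFor E T S := ⟨S, h⟩
  rw [moduleAdjoint, dif_pos hex]
  obtain ⟨n, l, hl⟩ := hE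
  ext y
  rw [(hl (hex.choose y)).2, (hl (S y)).2]
  exact Finset.sum_congr rfl fun i _ => by rw [← h, ← hex.choose_spec]

/-- The Jones projection of a conditional expectation `F`, as an operator on the Hilbert module
`A`. -/
def jonesProjection (F : A →ₗ[ℂ] A) : Module.End ℂ A := F

/-- The basic construction `A₁ = span {x e_B y : x, y ∈ A}`. -/
def basicConstruction (E : A →ₗ[ℂ] A) : Submodule ℂ (Module.End ℂ A) :=
  Submodule.span ℂ {T | ∃ x y : A,
    T = LinearMap.mulLeft ℂ x * jonesProjection E * LinearMap.mulLeft ℂ y}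

/-- If `E` has finite index, then every right `B`-linear operator lies in `A₁`. -/
theorem mem_basicConstruction {B : StarSubalgebra ℂ A} {E : A →ₗ[ℂ] A} (hE : IsCondExp B E)
    (hf : HasFiniteIndex E) {T : Module.End ℂ A} (hT : ∀ a, ∀ b ∈ B, T (a * b) = T a * b) :
    T ∈ basicConstruction E := by
  obtain ⟨n, l, hl⟩ := hf
  have h : T = ∑ i, LinearMap.mulLeft ℂ (T (l i)) * jonesProjection E *
      LinearMap.mulLeft ℂ (star (l i)) := by
    ext x
    conv_lhs => rw [(hl x).2]
    simp [jonesProjection, hT _ _ (hE.mem _)]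
  rw [h]
  exact Submodule.sum_mem _ fun i _ => Submodule.subset_span ⟨_, _, rfl⟩

/-- The dual conditional expectation `E₁ : A₁ → A`. It is determined on `A₁` by
`E₁(x e_B y) = Ind(E)⁻¹ x y`, see `dualExp_apply`; the formula used here makes sense for all
operators. -/
def dualExp (E : A →ₗ[ℂ] A) : Module.End ℂ A →ₗ[ℂ] A where
  toFun T := Ring.inverse (watataniIndex E) *
    ∑ i, T ((quasiBasis E).2 i) * star ((quasiBasis E).2 i)
  map_add' S T := by simp [add_mul, Finset.sum_add_distrib, mul_add]
  map_smul' c T := by simp [← Finset.smul_sum]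

theorem dualExp_apply {E : A →ₗ[ℂ] A} (hE : HasFiniteIndex E) (x y : A) :
    dualExp E (LinearMap.mulLeft ℂ x * jonesProjection E * LinearMap.mulLeft ℂ y) =
      Ring.inverse (watataniIndex E) * (x * y) := by
  have h := (isQuasiBasis_quasiBasis hE y).1
  simp only [dualExp, LinearMap.coe_mk, AddHom.coe_mk, Module.End.mul_apply,
    LinearMap.mulLeft_apply, jonesProjection, mul_assoc, ← Finset.mul_sum]
  rw [← h]

/-- The `A`-valued inner product `⟨X, Y⟩_A = E₁(X^* Y)` on `A₁`. -/
def dualInner (E : A →ₗ[ℂ] A) (X Y : Module.End ℂ A) : A :=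
  dualExp E (moduleAdjoint E X * Y)

/-- The norm `‖X‖_{A₁} = ‖E₁(X^* X)‖^{1/2}` on `A₁`. -/
def dualNorm (E : A →ₗ[ℂ] A) (X : Module.End ℂ A) : ℝ := √‖dualInner E X X‖

/-- `θ` is the interior angle between `C, D ∈ IMS(B, A, E) \ {B}`: the number in `[0, π/2]` with
`cos θ = ‖⟨e_C - e_B, e_D - e_B⟩_A‖ / (‖e_C - e_B‖_{A₁} ‖e_D - e_B‖_{A₁})`. -/
def IsInteriorAngle (B : StarSubalgebra ℂ A) (E : A →ₗ[ℂ] A) (C D : StarSubalgebra ℂ A)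
    (θ : ℝ) : Prop :=
  (C ∈ IMS B E ∧ C ≠ B) ∧ (D ∈ IMS B E ∧ D ≠ B) ∧ θ ∈ Set.Icc 0 (Real.pi / 2) ∧
  ∃ F F' : A →ₗ[ℂ] A, IsCompatibleExp E C F ∧ IsCompatibleExp E D F' ∧
    Real.cos θ =
      ‖dualInner E (jonesProjection F - jonesProjection E)
          (jonesProjection F' - jonesProjection E)‖ /
        (dualNorm E (jonesProjection F - jonesProjection E) *
          dualNorm E (jonesProjection F' - jonesProjection E))

end Watatani

end

noncomputable section

open SkewMonoidAlgebra

/-! ### Inclusion and restriction for the *-algebras `C_c(G, P)` -/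

section Algebra

variable {G P : Type*} [Group G] [CStarAlgebra P] [MulSemiringAction G P] [StarAction G P]

/-! For a subgroup M of finite index let e_M be the extension to A of the projection that keeps the
coefficients in M (`condExp`). It is a conditional expectation onto the image of P ⋊ M, and e_M e_N
= e_{M ∩ N} because this holds coefficientwise. K and L contain H, so they too have finite index.
Thus E = e_H, the compatible expectations onto C and D are e_K and e_L, and (e_K - e_H)(e_L - e_H) =
e_{K ∩ L} - e_H.

Representatives u_q of the left cosets of H form a quasi-basis of unitaries, so Ind(E) = [G:H]. For
H ≤ M, e_M(u_q) is u_q or 0 according to whether the representative lies in M, so E_1(e_M) = [G:H]⁻¹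
∑ e_M(u_q) u_q^* = [M:H]/[G:H] (`dualExp_condExp`). Every inner product in the definition of the
angle is therefore a scalar, ([K ∩ L:H] - 1)/[G:H] for the pair K, L (`dualInner_condExp`), and
[G:H] cancels from the quotient.

The analysis lies in extending the algebra to completions: in both norms the restriction C_c(G, P) →
C_c(M, P) must be contractive and the inclusion isometric. For the reduced norm, restriction is
compression to ℓ²(M), and the inclusion is handled by Fourier coefficients
(`norm_regularRep_ccIncl`). For the universal norm, a representation of C_c(M, P) is induced to 𝓗 ⊗
ℓ²(G/M), and compression to one summand recovers the restriction (`norm_rep_ccRestrict_le`). Finally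
A must be nonzero, which follows from a GNS representation of P or from the given faithful one. This
separates C and D from A and B and makes the norm of a scalar its absolute value. -/

theorem ccIncl_single (M : Subgroup G) (m : M) (a : P) :
    ccIncl M (single m a) = single (m : G) a := mapDomain_single

theorem ccRestrict_single_of_mem (M : Subgroup G) {g : G} (hg : g ∈ M) (a : P) :
    ccRestrict M (single g a) = single ⟨g, hg⟩ a := by
  classical
  ext m
  simp [ccRestrict, Finsupp.single_apply, Subtype.ext_iff]

theorem ccRestrict_single_of_notMem (M : Subgroup G) {g : G} (hg : g ∉ M) (a : P) :
    ccRestrict M (single g a) = 0 := by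
  ext m
  have : g ≠ m := fun h => hg (h ▸ m.2)
  simp [ccRestrict, this]

/-- The restriction map `C_c(G, P) → C_c(M, P)` as a linear map. -/
def ccRestrictₗ (M : Subgroup G) : SkewMonoidAlgebra P G →ₗ[ℂ] SkewMonoidAlgebra P M where
  toFun := ccRestrict M
  map_add' x y := by ext m; simp [ccRestrict]
  map_smul' c x := by ext m; simp [ccRestrict]

theorem ccRestrictₗ_apply (M : Subgroup G) (x : SkewMonoidAlgebra P G) :
    ccRestrictₗ M x = ccRestrict M x := rfl

theorem ccRestrict_add (M : Subgroup G) (x y : SkewMonoidAlgebra P G) :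
    ccRestrict M (x + y) = ccRestrict M x + ccRestrict M y := map_add (ccRestrictₗ M) x y

theorem ccRestrict_zero (M : Subgroup G) : ccRestrict M (0 : SkewMonoidAlgebra P G) = 0 :=
  map_zero (ccRestrictₗ M)

theorem ccIncl_add (M : Subgroup G) (x y : SkewMonoidAlgebra P M) :
    ccIncl M (x + y) = ccIncl M x + ccIncl M y := map_add (mapDomain M.subtype) x y

theorem ccIncl_zero (M : Subgroup G) : ccIncl M (0 : SkewMonoidAlgebra P M) = 0 :=
  map_zero (mapDomain M.subtype)

/-- The inclusion `C_c(M, P) → C_c(G, P)` as a *-homomorphism. -/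
def ccInclHom (M : Subgroup G) : SkewMonoidAlgebra P M →⋆ₐ[ℂ] SkewMonoidAlgebra P G where
  toFun := ccIncl M
  map_zero' := ccIncl_zero M
  map_add' := ccIncl_add M
  map_one' := ccIncl_single M 1 1
  map_mul' x y := by
    induction x using induction_on with
    | zero => simp [ccIncl_zero]
    | single s a =>
      induction y using induction_on with
      | zero => simp [ccIncl_zero]
      | single t b => simp [ccIncl_single, single_mul_single, Subgroup.smul_def]
      | add x y hx hy => rw [mul_add, ccIncl_add, hx, hy, ccIncl_add, mul_add]
    | add x z hx hz => rw [add_mul, ccIncl_add, hx, hz, ccIncl_add, add_mul]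
  commutes' r := by
    simp [coe_algebraMap, ccIncl_single]
  map_star' x := by
    induction x using induction_on with
    | zero => simp [ccIncl_zero]
    | single s a => simp [ccIncl_single, star_single, Subgroup.smul_def]
    | add x y hx hy => rw [star_add, ccIncl_add, hx, hy, ccIncl_add, star_add]

theorem ccInclHom_apply (M : Subgroup G) (x : SkewMonoidAlgebra P M) :
    ccInclHom M x = ccIncl M x := rfl

theorem ccRestrict_ccIncl (M : Subgroup G) (y : SkewMonoidAlgebra P M) :
    ccRestrict M (ccIncl M y) = y := by
  induction y using induction_on with
  | zero => simp [ccIncl_zero, ccRestrict_zero]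
  | single s a => rw [ccIncl_single, ccRestrict_single_of_mem M s.2]
  | add x y hx hy => rw [ccIncl_add, ccRestrict_add, hx, hy]

theorem ccRestrict_star (M : Subgroup G) (x : SkewMonoidAlgebra P G) :
    ccRestrict M (star x) = star (ccRestrict M x) := by
  induction x using induction_on with
  | zero => simp [ccRestrict_zero]
  | single s a =>
    rw [star_single]
    by_cases hs : s ∈ M
    · rw [ccRestrict_single_of_mem M hs, ccRestrict_single_of_mem M (inv_mem hs), star_single]
      rfl
    · rw [ccRestrict_single_of_notMem M hs, ccRestrict_single_of_notMem M (by simpa using hs),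
        star_zero]
  | add x y hx hy => rw [star_add, ccRestrict_add, hx, hy, ccRestrict_add, star_add]

/-- For s in M, the product st lies in M exactly when t does. This is the source of the bimodule
property of the conditional expectations. -/
theorem ccRestrict_ccIncl_mul (M : Subgroup G) (y : SkewMonoidAlgebra P M)
    (x : SkewMonoidAlgebra P G) : ccRestrict M (ccIncl M y * x) = y * ccRestrict M x := by
  induction y using induction_on with
  | zero => simp [ccIncl_zero, ccRestrict_zero]
  | single s a =>
    induction x using induction_on with
    | zero => simp [ccRestrict_zero]
    | single t b =>
      rw [ccIncl_single, single_mul_single]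
      by_cases ht : t ∈ M
      · rw [ccRestrict_single_of_mem M ht, ccRestrict_single_of_mem M (mul_mem s.2 ht),
          single_mul_single]
        rfl
      · rw [ccRestrict_single_of_notMem M ht, mul_zero,
          ccRestrict_single_of_notMem M (by rwa [M.mul_mem_cancel_left s.2])]
    | add x y hx hy => rw [mul_add, ccRestrict_add, hx, hy, ccRestrict_add, mul_add]
  | add x z hx hz => rw [ccIncl_add, add_mul, ccRestrict_add, hx, hz, add_mul]

theorem ccRestrict_mul_ccIncl (M : Subgroup G) (x : SkewMonoidAlgebra P G)
    (y : SkewMonoidAlgebra P M) : ccRestrict M (x * ccIncl M y) = ccRestrict M x * y := by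
  have h := ccRestrict_ccIncl_mul M (star y) (star x)
  rw [← ccInclHom_apply, map_star, ← star_mul, ccRestrict_star, ccRestrict_star, ← star_mul] at h
  exact star_injective h

/-- The projection of `C_c(G, P)` onto `C_c(M, P)`, as a linear endomorphism of `C_c(G, P)`. -/
def ccProj (M : Subgroup G) : SkewMonoidAlgebra P G →ₗ[ℂ] SkewMonoidAlgebra P G :=
  (ccInclHom M).toAlgHom.toLinearMap ∘ₗ ccRestrictₗ M

theorem ccProj_apply (M : Subgroup G) (x : SkewMonoidAlgebra P G) :
    ccProj M x = ccIncl M (ccRestrict M x) := rfl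

theorem ccProj_single_of_mem (M : Subgroup G) {g : G} (hg : g ∈ M) (a : P) :
    ccProj M (single g a) = single g a := by
  rw [ccProj_apply, ccRestrict_single_of_mem M hg, ccIncl_single]

theorem ccProj_single_of_notMem (M : Subgroup G) {g : G} (hg : g ∉ M) (a : P) :
    ccProj M (single g a) = 0 := by
  rw [ccProj_apply, ccRestrict_single_of_notMem M hg, ccIncl_zero]

theorem ccProj_ccIncl (M : Subgroup G) (y : SkewMonoidAlgebra P M) :
    ccProj M (ccIncl M y) = ccIncl M y := by rw [ccProj_apply, ccRestrict_ccIncl]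

theorem ccProj_star (M : Subgroup G) (x : SkewMonoidAlgebra P G) :
    ccProj M (star x) = star (ccProj M x) := by
  rw [ccProj_apply, ccProj_apply, ccRestrict_star, ← ccInclHom_apply, map_star]; rfl

theorem ccProj_ccIncl_mul (M : Subgroup G) (y : SkewMonoidAlgebra P M)
    (x : SkewMonoidAlgebra P G) : ccProj M (ccIncl M y * x) = ccIncl M y * ccProj M x := by
  rw [ccProj_apply, ccProj_apply, ccRestrict_ccIncl_mul, ← ccInclHom_apply, map_mul]; rfl

/-- This commutation is what turns the angle into a count of cosets of H in K ∩ L. -/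
theorem ccProj_ccProj (M N : Subgroup G) (x : SkewMonoidAlgebra P G) :
    ccProj M (ccProj N x) = ccProj (M ⊓ N) x := by
  induction x using induction_on with
  | zero => simp
  | single s a =>
    by_cases hN : s ∈ N
    · rw [ccProj_single_of_mem N hN]
      by_cases hM : s ∈ M
      · rw [ccProj_single_of_mem M hM, ccProj_single_of_mem (M ⊓ N) ⟨hM, hN⟩]
      · rw [ccProj_single_of_notMem M hM, ccProj_single_of_notMem (M ⊓ N) fun h => hM h.1]
    · rw [ccProj_single_of_notMem N hN, ccProj_single_of_notMem (M ⊓ N) fun h => hN h.2, map_zero]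
  | add x y hx hy => rw [map_add, map_add, hx, hy, map_add]

/-- The element of `C_c(G, P)` given by a representative of a left coset of `M`. -/
def cosetElt (P : Type*) [CStarAlgebra P] [MulSemiringAction G P] (M : Subgroup G) (q : G ⧸ M) :
    SkewMonoidAlgebra P G := single q.out 1

theorem star_cosetElt (M : Subgroup G) (q : G ⧸ M) :
    star (cosetElt P M q) = single q.out⁻¹ 1 := by
  rw [cosetElt, star_single, star_one, smul_one]

theorem cosetElt_mul_star (M : Subgroup G) (q : G ⧸ M) :
    cosetElt P M q * star (cosetElt P M q) = 1 := by
  rw [star_cosetElt, cosetElt, single_mul_single, mul_inv_cancel, smul_one, mul_one, one_def]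

theorem star_cosetElt_mul (M : Subgroup G) (q : G ⧸ M) :
    star (cosetElt P M q) * cosetElt P M q = 1 := by
  rw [star_cosetElt, cosetElt, single_mul_single, inv_mul_cancel, smul_one, mul_one, one_def]

/-- On a monomial at g only the coset gM contributes, since q.out⁻¹ g lies in M exactly for that q.
This is the quasi-basis identity before completion, and also what makes `inducedRep` multiplicative.
-/
theorem sum_cosetElt_mul_ccProj (M : Subgroup G) [Fintype (G ⧸ M)] (x : SkewMonoidAlgebra P G) :
    ∑ q, cosetElt P M q * ccProj M (star (cosetElt P M q) * x) = x := by
  induction x using induction_on with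
  | zero => simp
  | single g a =>
    rw [Finset.sum_eq_single (g : G ⧸ M)]
    · rw [star_cosetElt, single_mul_single, ccProj_single_of_mem, cosetElt, single_mul_single]
      · simp
      · rw [← QuotientGroup.eq]; simp
    · intro q _ hq
      rw [star_cosetElt, single_mul_single, ccProj_single_of_notMem, mul_zero]
      rw [← QuotientGroup.eq]; simpa using hq
    · simp
  | add x y hx hy => simp only [mul_add, map_add, Finset.sum_add_distrib, hx, hy]

end Algebra

/-! ### Extension of maps to completions -/

namespace CStarSeminorm

variable {R : Type*} [Ring R] [StarRing R] [Algebra ℂ R] (p : CStarSeminorm R)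

section Linear

variable {F : Type*} [NormedAddCommGroup F] [NormedSpace ℂ F] [CompleteSpace F]

/-- The extension of a linear map that is bounded by `p` to the completion. -/
def liftL (f : R →ₗ[ℂ] F) : p.Compl →L[ℂ] F :=
  f.extendOfNorm p.toCompl.toAlgHom.toLinearMap

/-- `liftL` itself carries no boundedness hypothesis; the bound is needed here for it to extend `f`.
-/
theorem liftL_toCompl {f : R →ₗ[ℂ] F} (h : ∀ x, ‖f x‖ ≤ p.toSeminorm x) (x : R) :
    p.liftL f (p.toCompl x) = f x :=
  LinearMap.extendOfNorm_eq (e := p.toCompl.toAlgHom.toLinearMap) p.denseRange_toCompl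
    ⟨1, fun x => (h x).trans (by rw [one_mul]; exact (p.norm_toCompl x).ge)⟩ x

end Linear

theorem isClosed_induction {motive : p.Compl → Prop} (hc : IsClosed {z | motive z})
    (h : ∀ x, motive (p.toCompl x)) (z : p.Compl) : motive z :=
  isClosed_property p.denseRange_toCompl hc h z

/-- The extension of a *-homomorphism that is bounded by `p` to the completion. -/
def lift {C : Type*} [CStarAlgebra C] (f : R →⋆ₐ[ℂ] C) (h : ∀ x, ‖f x‖ ≤ p.toSeminorm x) :
    p.Compl →⋆ₐ[ℂ] C :=
  have hl : ∀ x, p.liftL f.toAlgHom.toLinearMap (p.toCompl x) = f x := p.liftL_toCompl h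
  have h1 : p.liftL f.toAlgHom.toLinearMap 1 = 1 := by rw [← map_one p.toCompl, hl, map_one]
  { toFun := p.liftL f.toAlgHom.toLinearMap
    map_zero' := map_zero _
    map_add' := map_add _
    map_one' := h1
    map_mul' := fun x y => by
      induction x using p.isClosed_induction with
      | hc => exact isClosed_eq (by fun_prop) (by fun_prop)
      | h x =>
        induction y using p.isClosed_induction with
        | hc => exact isClosed_eq (by fun_prop) (by fun_prop)
        | h y => rw [← map_mul, hl, hl, hl, map_mul]
    commutes' := fun r => by
      rw [Algebra.algebraMap_eq_smul_one, map_smul, h1, Algebra.algebraMap_eq_smul_one]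
    map_star' := fun x => by
      induction x using p.isClosed_induction with
      | hc =>
        exact isClosed_eq ((p.liftL _).continuous.comp p.continuous_star)
          (by fun_prop)
      | h x => rw [← map_star, hl, hl, map_star] }

theorem lift_toCompl {C : Type*} [CStarAlgebra C] {f : R →⋆ₐ[ℂ] C}
    (h : ∀ x, ‖f x‖ ≤ p.toSeminorm x) (x : R) : p.lift f h (p.toCompl x) = f x :=
  p.liftL_toCompl (f := f.toAlgHom.toLinearMap) h x

end CStarSeminorm

theorem StarAlgHom.continuous_of_cstarAlgebra {A B : Type*} [CStarAlgebra A] [CStarAlgebra B]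
    (φ : A →⋆ₐ[ℂ] B) : Continuous φ :=
  AddMonoidHomClass.continuous_of_bound φ 1 fun a => by
    rw [one_mul]; exact NonUnitalStarAlgHom.norm_apply_le φ a

/-! ### Norm estimates for the reduced norm -/

section Reduced

variable {G P : Type*} [Group G] [CStarAlgebra P] [MulSemiringAction G P] [StarAction G P]
variable {𝓗 : Type*} [NormedAddCommGroup 𝓗] [InnerProductSpace ℂ 𝓗] [CompleteSpace 𝓗]

theorem StarAction.norm_smul (g : G) (a : P) : ‖g • a‖ = ‖a‖ :=
  le_antisymm (StarAction.norm_smul_le g a) (by simpa using StarAction.norm_smul_le g⁻¹ (g • a))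

theorem StarAction.continuous_smul (g : G) : Continuous fun a : P => g • a :=
  (AddMonoidHomClass.isometry_of_norm (DistribSMul.toAddMonoidHom P g)
    (StarAction.norm_smul g)).continuous

theorem regularRep_single (ρ : P →⋆ₐ[ℂ] (𝓗 →L[ℂ] 𝓗)) (s : G) (a : P) :
    regularRep ρ (single s a) = regularOp ρ s a := regularSum_single ρ s a

/-- The matrix entry at (t, s) sees only the coefficient at ts⁻¹, so the operator determines and
bounds the Fourier coefficients. -/
theorem regularRep_lp_single [DecidableEq G] (ρ : P →⋆ₐ[ℂ] (𝓗 →L[ℂ] 𝓗))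
    (x : SkewMonoidAlgebra P G) (s t : G) (v : 𝓗) :
    regularRep ρ x (lp.single 2 s v) t = ρ (t⁻¹ • x.coeff (t * s⁻¹)) v := by
  induction x using induction_on with
  | zero => simp
  | single r a =>
    rw [regularRep_single, regularOp_apply, coeff_single, Finsupp.single_apply, lp.single_apply,
      Pi.single_apply]
    by_cases h : r = t * s⁻¹
    · subst h; simp
    · rw [if_neg h, if_neg (by rintro rfl; simp at h)]; simp
  | add x y hx hy => simp [hx, hy, smul_add]

theorem norm_rep_coeff_le (ρ : P →⋆ₐ[ℂ] (𝓗 →L[ℂ] 𝓗)) (x : SkewMonoidAlgebra P G) (t : G) :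
    ‖ρ (t⁻¹ • x.coeff t)‖ ≤ ‖regularRep ρ x‖ := by
  classical
  refine ContinuousLinearMap.opNorm_le_bound _ (norm_nonneg _) fun v => ?_
  have h := regularRep_lp_single ρ x 1 t v
  rw [inv_one, mul_one] at h
  rw [← h]
  refine (lp.norm_apply_le_norm (by norm_num) _ t).trans
    ((ContinuousLinearMap.le_opNorm _ _).trans_eq ?_)
  rw [lp.norm_single (by norm_num)]

theorem norm_coeff_le_norm_regularRep {ρ : P →⋆ₐ[ℂ] (𝓗 →L[ℂ] 𝓗)} (hρ : Function.Injective ρ)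
    (x : SkewMonoidAlgebra P G) (t : G) : ‖x.coeff t‖ ≤ ‖regularRep ρ x‖ := by
  have h := norm_rep_coeff_le ρ x t
  rwa [NonUnitalStarAlgHom.norm_map ρ hρ, StarAction.norm_smul] at h

theorem HilbertTensor.exists_extend_zero (M : Subgroup G) (ξ : HilbertTensor M 𝓗) :
    ∃ η : HilbertTensor G 𝓗, (∀ m : M, η m = ξ m) ∧ (∀ g, g ∉ M → η g = 0) ∧ ‖η‖ = ‖ξ‖ := by
  classical
  let f : G → 𝓗 := fun g => if h : g ∈ M then ξ ⟨g, h⟩ else 0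
  have hf : ∀ m : M, f m = ξ m := fun m => dif_pos m.2
  have hf0 : ∀ g, g ∉ M → f g = 0 := fun g hg => dif_neg hg
  have hs : HasSum (fun g => ‖f g‖ ^ 2) (‖ξ‖ ^ 2) := by
    refine (Subtype.val_injective.hasSum_iff (g := ((↑) : M → G)) fun g hg => ?_).1 ?_
    · rw [hf0 g (by simpa using hg)]; simp
    · simpa only [Function.comp_def, hf] using hasSum_sq_norm ξ
  have hm : Memℓp f 2 := memℓp_gen (by simpa using hs.summable)
  refine ⟨⟨f, hm⟩, hf, hf0, ?_⟩
  refine (sq_eq_sq₀ (norm_nonneg _) (norm_nonneg _)).1 ?_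
  exact (hasSum_sq_norm ⟨f, hm⟩).unique hs

theorem HilbertTensor.norm_le_of_eq_restrict (M : Subgroup G) {ζ : HilbertTensor M 𝓗}
    {η : HilbertTensor G 𝓗} (h : ∀ m : M, ζ m = η m) : ‖ζ‖ ≤ ‖η‖ := by
  refine (sq_le_sq₀ (norm_nonneg _) (norm_nonneg _)).1 ?_
  exact hasSum_le_inj ((↑) : M → G) Subtype.val_injective (fun _ _ => by positivity)
    (fun m => by rw [h]) (hasSum_sq_norm ζ) (hasSum_sq_norm η)

/-- For m in M the point s⁻¹m lies in M exactly when s does, so coefficients outside M only meet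
values of η that vanish. Hence restriction to M is compression to 𝓗 ⊗ ℓ²(M). -/
theorem regularRep_ccRestrict_apply (ρ : P →⋆ₐ[ℂ] (𝓗 →L[ℂ] 𝓗)) (M : Subgroup G)
    (x : SkewMonoidAlgebra P G) {ξ : HilbertTensor M 𝓗} {η : HilbertTensor G 𝓗}
    (h : ∀ m : M, η m = ξ m) (h0 : ∀ g, g ∉ M → η g = 0) (m : M) :
    regularRep ρ (ccRestrict M x) ξ m = regularRep ρ x η m := by
  induction x using induction_on with
  | zero => simp [ccRestrict_zero]
  | single s a =>
    rw [regularRep_single, regularOp_apply]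
    by_cases hs : s ∈ M
    · rw [ccRestrict_single_of_mem M hs, regularRep_single, regularOp_apply, ← h]
      rfl
    · rw [ccRestrict_single_of_notMem M hs, h0]
      · simp
      · rwa [M.mul_mem_cancel_right m.2, inv_mem_iff]
  | add x y hx hy => simp [ccRestrict_add, hx, hy]

theorem norm_regularRep_ccRestrict_le (ρ : P →⋆ₐ[ℂ] (𝓗 →L[ℂ] 𝓗)) (M : Subgroup G)
    (x : SkewMonoidAlgebra P G) : ‖regularRep ρ (ccRestrict M x)‖ ≤ ‖regularRep ρ x‖ := by
  refine ContinuousLinearMap.opNorm_le_bound _ (norm_nonneg _) fun ξ => ?_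
  obtain ⟨η, h, h0, hn⟩ := HilbertTensor.exists_extend_zero M ξ
  rw [← hn]
  exact (HilbertTensor.norm_le_of_eq_restrict M
    (regularRep_ccRestrict_apply ρ M x h h0)).trans (ContinuousLinearMap.le_opNorm _ _)

theorem coeff_ccIncl_of_mem (M : Subgroup G) (y : SkewMonoidAlgebra P M) {g : G} (hg : g ∈ M) :
    (ccIncl M y).coeff g = y.coeff ⟨g, hg⟩ := by
  conv_rhs => rw [← ccRestrict_ccIncl M y]
  rfl

theorem coeff_ccIncl_of_notMem (M : Subgroup G) (y : SkewMonoidAlgebra P M) {g : G}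
    (hg : g ∉ M) : (ccIncl M y).coeff g = 0 := by
  induction y using induction_on with
  | zero => simp [ccIncl_zero]
  | single s a =>
    have : (s : G) ≠ g := fun h => hg (h ▸ s.2)
    simp [ccIncl_single, this]
  | add x y hx hy => simp [ccIncl_add, hx, hy]

/-- A C*-seminorm on `C_c(M, P)` that comes from the regular representation of `C_c(G, P)` agrees
with the reduced norm: the elements of its completion are determined by their Fourier
coefficients. -/
theorem toSeminorm_eq_of_regularRep {ρ : P →⋆ₐ[ℂ] (𝓗 →L[ℂ] 𝓗)} (hρ : Function.Injective ρ)
    (M : Subgroup G) (p q : CStarSeminorm (SkewMonoidAlgebra P M))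
    (hp : ∀ y, p.toSeminorm y = ‖regularRep ρ (ccIncl M y)‖)
    (hq : ∀ y, q.toSeminorm y = ‖regularRep ρ y‖) (y : SkewMonoidAlgebra P M) :
    p.toSeminorm y = q.toSeminorm y := by
  classical
  have hqp : ∀ y, ‖q.toCompl y‖ ≤ p.toSeminorm y := fun y => by
    rw [q.norm_toCompl, hp, hq]
    conv_lhs => rw [← ccRestrict_ccIncl M y]
    exact norm_regularRep_ccRestrict_le ρ M _
  obtain ⟨φ, hφ⟩ : ∃ φ : p.Compl →⋆ₐ[ℂ] q.Compl, ∀ y, φ (p.toCompl y) = q.toCompl y :=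
    ⟨p.lift q.toCompl hqp, p.lift_toCompl hqp⟩
  -- `lam` realizes the completion for `p` isometrically on 𝓗 ⊗ ℓ²(G), while `φ` maps it to the
  -- completion for `q`. It remains to see that `φ` is injective, since an injective *-homomorphism
  -- of C*-algebras is isometric.
  obtain ⟨lam, hlam⟩ : ∃ lam : p.Compl →L[ℂ] HilbertTensor G 𝓗 →L[ℂ] HilbertTensor G 𝓗,
      ∀ y, lam (p.toCompl y) = regularRep ρ (ccIncl M y) := by
    let f : SkewMonoidAlgebra P M →ₗ[ℂ] HilbertTensor G 𝓗 →L[ℂ] HilbertTensor G 𝓗 :=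
      ((regularRep ρ : SkewMonoidAlgebra P G →⋆ₙₐ[ℂ] _) : SkewMonoidAlgebra P G →ₗ[ℂ] _) ∘ₗ
        (ccInclHom M).toAlgHom.toLinearMap
    exact ⟨p.liftL f, p.liftL_toCompl (f := f) fun y => (hp y).ge⟩
  have hnorm : ∀ z, ‖lam z‖ = ‖z‖ := fun z => by
    induction z using p.isClosed_induction with
    | hc => exact isClosed_eq lam.continuous.norm continuous_norm
    | h y => rw [hlam, p.norm_toCompl, hp]
  have hc : ∀ m : M, ∃ c : q.Compl →L[ℂ] P, ∀ y, c (q.toCompl y) = y.coeff m := fun m => by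
    let f : SkewMonoidAlgebra P M →ₗ[ℂ] P :=
      Finsupp.lapply m ∘ₗ (coeffLinearEquiv (S := ℂ)).toLinearMap
    exact ⟨q.liftL f, q.liftL_toCompl (f := f) fun y =>
      (norm_coeff_le_norm_regularRep hρ y m).trans (hq y).ge⟩
  choose c hc using hc
  have hφc : Continuous φ := φ.continuous_of_cstarAlgebra
  -- All matrix entries of `lam z` are computed from the Fourier coefficients of `φ z`, so `φ z = 0`
  -- forces `lam z = 0` and then z = 0.
  have hmat : ∀ z s t v, lam z (lp.single 2 s v) t =
      if h : t * s⁻¹ ∈ M then ρ (t⁻¹ • c ⟨_, h⟩ (φ z)) v else 0 := fun z s t v => by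
    have hcont : Continuous fun z => lam z (lp.single 2 s v) t :=
      ((lp.evalCLM ℂ (fun _ : G => 𝓗) 2 t).continuous).comp
        (lam.continuous.clm_apply continuous_const)
    induction z using p.isClosed_induction with
    | hc =>
      refine isClosed_eq hcont ?_
      split_ifs with h
      · exact ((ρ.continuous_of_cstarAlgebra.comp ((StarAction.continuous_smul t⁻¹).comp
          ((c ⟨_, h⟩).continuous.comp hφc))).clm_apply continuous_const)
      · exact continuous_const
    | h y =>
      rw [hlam, regularRep_lp_single, hφ]
      split_ifs with h
      · rw [hc, coeff_ccIncl_of_mem M y h]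
      · rw [coeff_ccIncl_of_notMem M y h]; simp
  have hinj : Function.Injective φ := by
    refine (injective_iff_map_eq_zero φ).2 fun z hz => ?_
    rw [← norm_eq_zero, ← hnorm, norm_eq_zero]
    refine lp.ext_continuousLinearMap (by norm_num) fun s => ?_
    ext v t
    simp [hmat, hz]
  have := NonUnitalStarAlgHom.norm_map φ hinj (p.toCompl y)
  rw [hφ, p.norm_toCompl, q.norm_toCompl] at this
  exact this.symm

theorem norm_regularRep_ccIncl {ρ : P →⋆ₐ[ℂ] (𝓗 →L[ℂ] 𝓗)} (hρ : Function.Injective ρ)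
    (M : Subgroup G) (y : SkewMonoidAlgebra P M) :
    ‖regularRep ρ (ccIncl M y)‖ = ‖regularRep ρ y‖ :=
  toSeminorm_eq_of_regularRep hρ M
    (.ofHom ((regularRep ρ).comp (ccInclHom M).toNonUnitalStarAlgHom)) (reducedNorm ρ)
    (fun _ => rfl) (fun _ => rfl) y

end Reduced

/-! ### Norm estimates for the universal norm -/

section Induced

variable {G P : Type*} [Group G] [CStarAlgebra P] [MulSemiringAction G P] [StarAction G P]
variable {𝓗 : Type*} [NormedAddCommGroup 𝓗] [InnerProductSpace ℂ 𝓗] [CompleteSpace 𝓗]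

open scoped Classical in
/-- The isometry of `𝓗` onto the summand `i` of `𝓗 ⊗ ℓ²(ι)`. -/
def summandIncl {ι : Type*} (i : ι) : 𝓗 →L[ℂ] HilbertTensor ι 𝓗 :=
  lp.singleContinuousLinearMap ℂ (fun _ : ι => 𝓗) 2 i

theorem norm_summandIncl_le {ι : Type*} (i : ι) :
    ‖(summandIncl i : 𝓗 →L[ℂ] HilbertTensor ι 𝓗)‖ ≤ 1 :=
  ContinuousLinearMap.opNorm_le_bound _ zero_le_one fun v => by
    classical
    rw [one_mul]
    exact (lp.norm_single (E := fun _ : ι => 𝓗) (p := 2) (by norm_num) i v).le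

open ContinuousLinearMap in
open scoped Classical in
theorem adjoint_summandIncl_comp {ι : Type*} (i j : ι) :
    (adjoint (summandIncl i : 𝓗 →L[ℂ] HilbertTensor ι 𝓗)).comp (summandIncl j) =
      if i = j then ContinuousLinearMap.id ℂ 𝓗 else 0 := by
  ext v
  refine ext_inner_left ℂ fun w => ?_
  rw [ContinuousLinearMap.comp_apply, adjoint_inner_right]
  simp only [summandIncl, lp.singleContinuousLinearMap_apply]
  rw [lp.inner_single_left, lp.single_apply, Pi.single_apply]
  split_ifs <;> simp

/-- The operator with matrix entry `T` at the place `(i, j)`. -/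
def matrixUnitOp {ι : Type*} (i j : ι) :
    (𝓗 →L[ℂ] 𝓗) →ₗ[ℂ] (HilbertTensor ι 𝓗 →L[ℂ] HilbertTensor ι 𝓗) where
  toFun T := (summandIncl i).comp (T.comp (ContinuousLinearMap.adjoint (summandIncl j)))
  map_add' S T := by simp
  map_smul' c T := by simp

theorem matrixUnitOp_apply {ι : Type*} (i j : ι) (T : 𝓗 →L[ℂ] 𝓗) : matrixUnitOp i j T =
    (summandIncl i).comp (T.comp (ContinuousLinearMap.adjoint (summandIncl j))) := rfl

/-- The operator on `𝓗 ⊗ ℓ²(G/M)` with the matrix entries `π(t_i^* x t_j |_M)`. -/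
def inducedOp (M : Subgroup G) [Fintype (G ⧸ M)]
    (π : SkewMonoidAlgebra P M →⋆ₙₐ[ℂ] (𝓗 →L[ℂ] 𝓗)) (x : SkewMonoidAlgebra P G) :
    HilbertTensor (G ⧸ M) 𝓗 →L[ℂ] HilbertTensor (G ⧸ M) 𝓗 :=
  ∑ i, ∑ j, matrixUnitOp i j
    (π (ccRestrict M (star (cosetElt P M i) * x * cosetElt P M j)))

theorem star_matrixUnitOp {ι : Type*} (i j : ι) (T : 𝓗 →L[ℂ] 𝓗) :
    star (matrixUnitOp i j T) = matrixUnitOp j i (star T) := by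
  simp only [matrixUnitOp_apply, ContinuousLinearMap.star_eq_adjoint,
    ContinuousLinearMap.adjoint_comp, ContinuousLinearMap.adjoint_adjoint, ContinuousLinearMap.comp_assoc]

open scoped Classical in
theorem matrixUnitOp_mul {ι : Type*} (i j k l : ι) (S T : 𝓗 →L[ℂ] 𝓗) :
    matrixUnitOp i j S * matrixUnitOp k l T = if j = k then matrixUnitOp i l (S * T) else 0 := by
  have : matrixUnitOp i j S * matrixUnitOp k l T = (summandIncl i).comp (S.comp
      (((ContinuousLinearMap.adjoint (summandIncl j)).comp (summandIncl k)).comp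
        (T.comp (ContinuousLinearMap.adjoint (summandIncl l))))) := rfl
  rw [this, adjoint_summandIncl_comp]
  split_ifs with h
  · rfl
  · simp

/-- The representation of `C_c(G, P)` induced by a representation of `C_c(M, P)`. -/
def inducedRep (M : Subgroup G) [Fintype (G ⧸ M)]
    (π : SkewMonoidAlgebra P M →⋆ₙₐ[ℂ] (𝓗 →L[ℂ] 𝓗)) :
    SkewMonoidAlgebra P G →⋆ₙₐ[ℂ] (HilbertTensor (G ⧸ M) 𝓗 →L[ℂ] HilbertTensor (G ⧸ M) 𝓗) where
  toFun := inducedOp M π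
  map_zero' := by simp [inducedOp, ccRestrict_zero]
  map_add' x y := by
    simp [inducedOp, mul_add, add_mul, ccRestrict_add, Finset.sum_add_distrib]
  map_smul' c x := by
    simp only [inducedOp, mul_smul_comm, smul_mul_assoc, ← ccRestrictₗ_apply, map_smul,
      Finset.smul_sum, MonoidHom.id_apply]
  map_mul' x y := by
    classical
    -- Inserting the coset expansion of the identity between x and y turns the entries of xy into a
    -- matrix product; the bimodule property splits each term.
    have key : ∀ i l, ccRestrict M (star (cosetElt P M i) * (x * y) * cosetElt P M l) =
        ∑ j, ccRestrict M (star (cosetElt P M i) * x * cosetElt P M j) *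
          ccRestrict M (star (cosetElt P M j) * y * cosetElt P M l) := fun i l => by
      conv_lhs =>
        rw [← mul_assoc, mul_assoc (star _ * x),
          ← sum_cosetElt_mul_ccProj M (y * cosetElt P M l), Finset.mul_sum,
          ← ccRestrictₗ_apply, _root_.map_sum]
      refine Finset.sum_congr rfl fun j _ => ?_
      rw [ccRestrictₗ_apply, ← mul_assoc, ccProj_apply, ccRestrict_mul_ccIncl, mul_assoc (star _) y]
    simp only [inducedOp, key, _root_.map_sum, map_mul, Finset.sum_mul]
    refine Finset.sum_congr rfl fun i _ => ?_
    rw [Finset.sum_comm]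
    refine Finset.sum_congr rfl fun j _ => ?_
    symm
    rw [Finset.mul_sum, Finset.sum_eq_single j]
    · simp only [Finset.mul_sum, matrixUnitOp_mul, if_true]
    · intro k _ hk
      simp only [Finset.mul_sum, matrixUnitOp_mul, if_neg hk.symm, Finset.sum_const_zero]
    · simp
  map_star' x := by
    simp only [inducedOp, star_sum, star_matrixUnitOp, ← map_star, ← ccRestrict_star, star_mul,
      star_star, mul_assoc]
    exact Finset.sum_comm

-- The (i, i) entry of the induced operator of t_i x t_i^* is π(x|_M), and cutting out an entry is
-- contractive. The conjugation is needed because the chosen representative of the trivial coset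
-- need not be 1.
open ContinuousLinearMap in
theorem norm_rep_ccRestrict_le (M : Subgroup G) [Fintype (G ⧸ M)]
    (π : SkewMonoidAlgebra P M →⋆ₙₐ[ℂ] (𝓗 →L[ℂ] 𝓗)) (x : SkewMonoidAlgebra P G) (i : G ⧸ M) :
    ‖π (ccRestrict M x)‖ ≤
      ‖inducedRep M π (cosetElt P M i * x * star (cosetElt P M i))‖ := by
  classical
  set T := inducedRep M π (cosetElt P M i * x * star (cosetElt P M i)) with hT
  have h : π (ccRestrict M x) = (adjoint (summandIncl i)).comp (T.comp (summandIncl i)) := by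
    have h1 : T = inducedOp M π (cosetElt P M i * x * star (cosetElt P M i)) := rfl
    have h2 : ∀ k l S, (adjoint (summandIncl i)).comp
        ((matrixUnitOp k l S : HilbertTensor (G ⧸ M) 𝓗 →L[ℂ] _).comp (summandIncl i)) =
        if k = i ∧ l = i then S else 0 := fun k l S => by
      have : (adjoint (summandIncl i)).comp
          ((matrixUnitOp k l S : HilbertTensor (G ⧸ M) 𝓗 →L[ℂ] _).comp (summandIncl i)) =
          ((adjoint (summandIncl i)).comp (summandIncl k)).comp
            (S.comp ((adjoint (summandIncl l)).comp (summandIncl i))) := rfl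
      rw [this, adjoint_summandIncl_comp, adjoint_summandIncl_comp]
      by_cases hk : k = i <;> by_cases hl : l = i <;> simp [hk, hl, eq_comm (a := i)]
    rw [h1, inducedOp]
    simp only [finsetSum_comp, comp_finsetSum, h2]
    rw [Finset.sum_eq_single i (by simp +contextual) (by simp),
      Finset.sum_eq_single i (by simp +contextual) (by simp), if_pos ⟨rfl, rfl⟩]
    congr 2
    simp only [← mul_assoc, star_cosetElt_mul, one_mul]
    rw [mul_assoc, star_cosetElt_mul, mul_one]
  rw [h]
  refine (opNorm_comp_le _ _).trans ?_
  have h3 := norm_summandIncl_le (𝓗 := 𝓗) i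
  calc _ ≤ 1 * (‖T‖ * 1) := by
        refine mul_le_mul ?_ ((opNorm_comp_le _ _).trans (by gcongr)) (norm_nonneg _) zero_le_one
        rwa [LinearIsometryEquiv.norm_map]
    _ = ‖T‖ := by ring

end Induced

section Universal

universe u v

variable {G : Type v} {P : Type u} [Group G] [CStarAlgebra P] [MulSemiringAction G P]
  [StarAction G P]

theorem universalNorm_mul_le (x y : SkewMonoidAlgebra P G) :
    universalNorm.toSeminorm (x * y) ≤ universalNorm.toSeminorm x * universalNorm.toSeminorm y :=
  universalNorm.mul_le x y

theorem universalNorm_single_one_le (g : G) :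
    universalNorm.toSeminorm (single g 1 : SkewMonoidAlgebra P G) ≤ 1 := by
  refine csSup_le (repNorms_nonempty _) ?_
  rintro _ ⟨𝓗, _, _, _, π, rfl⟩
  refine (norm_rep_single_le π g 1).trans ?_
  -- In the zero algebra ‖1‖ = 0, so only the inequality holds in general.
  rcases subsingleton_or_nontrivial P with h | h
  · simp [Subsingleton.elim (1 : P) 0]
  · exact CStarRing.norm_one.le

/-- The induced representation lives in the same universe as 𝓗, so it competes in the supremum for
G. Conjugation by a coset representative costs nothing, and any coset would serve. -/
theorem universalNorm_ccRestrict_le (M : Subgroup G) [M.FiniteIndex] (x : SkewMonoidAlgebra P G) :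
    universalNorm.toSeminorm (ccRestrict M x) ≤ universalNorm.toSeminorm x := by
  have := Fintype.ofFinite (G ⧸ M)
  refine csSup_le (repNorms_nonempty _) ?_
  rintro _ ⟨𝓗, _, _, _, π, rfl⟩
  refine (norm_rep_ccRestrict_le M π x ((1 : G) : G ⧸ M)).trans
    ((norm_rep_le_sSup (inducedRep M π)).trans ?_)
  refine (universalNorm_mul_le _ _).trans ?_
  refine (mul_le_of_le_one_right (apply_nonneg _ _) ?_).trans ((universalNorm_mul_le _ _).trans
    (mul_le_of_le_one_left (apply_nonneg _ _) (universalNorm_single_one_le _)))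
  rw [star_cosetElt]
  exact universalNorm_single_one_le _

/-- Representations of C_c(G, P) restrict to C_c(M, P), which gives one inequality; the other holds
because restriction is a contractive left inverse of the inclusion. -/
theorem universalNorm_ccIncl (M : Subgroup G) [M.FiniteIndex] (y : SkewMonoidAlgebra P M) :
    universalNorm.toSeminorm (ccIncl M y) = universalNorm.toSeminorm y := by
  refine le_antisymm (csSup_le (repNorms_nonempty _) ?_) ?_
  · rintro _ ⟨𝓗, _, _, _, π, rfl⟩
    exact norm_rep_le_sSup (π.comp (ccInclHom M).toNonUnitalStarAlgHom)
  · conv_lhs => rw [← ccRestrict_ccIncl M y]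
    exact universalNorm_ccRestrict_le M _

end Universal

/-! ### Existence of representations -/

section State

open scoped ComplexOrder CStarAlgebra

/-- A Hahn–Banach functional with ‖f‖ = f(1) = 1 is positive. -/
theorem exists_state (P : Type*) [CStarAlgebra P] [Nontrivial P] [PartialOrder P]
    [StarOrderedRing P] : ∃ f : P →ₚ[ℂ] ℂ, f 1 = 1 := by
  obtain ⟨f, hf, hf1⟩ := exists_dual_vector ℂ (1 : P) (by simp)
  rw [CStarRing.norm_one, RCLike.ofReal_one] at hf1
  have hle : ∀ a, ‖f a‖ ≤ ‖a‖ := fun a => by simpa [hf] using f.le_opNorm a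
  have him : ∀ a, IsSelfAdjoint a → (f a).im = 0 := fun a ha => by
    -- Shifting a self-adjoint a by it adds at most t² to its squared norm, whereas a nonzero Im
    -- f(a) would contribute a term linear in t. The value of t chosen below makes that term ‖a‖² +
    -- 1.
    have h : ∀ t : ℝ, ((f a).im + t) ^ 2 ≤ ‖a‖ ^ 2 + t ^ 2 := fun t => by
      have h1 : ‖a + (Complex.I * t) • (1 : P)‖ ^ 2 ≤ ‖a‖ ^ 2 + t ^ 2 := by
        rw [sq, ← CStarRing.norm_star_mul_self]
        have : star (a + (Complex.I * t) • (1 : P)) * (a + (Complex.I * t) • 1) =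
            a * a + ((t : ℂ) ^ 2) • 1 := by
          have hI : (Complex.I * t) * (Complex.I * t) = -(t : ℂ) ^ 2 := by
            rw [mul_mul_mul_comm, Complex.I_mul_I]; ring
          simp [ha.star_eq, mul_add, add_mul, smul_smul, hI]
        rw [this]
        refine (norm_add_le _ _).trans (add_le_add ((norm_mul_le _ _).trans (sq _).ge) ?_)
        rw [norm_smul, CStarRing.norm_one]; simp
      have h2 := hle (a + (Complex.I * t) • 1)
      have h3 : ((f a).im + t) ^ 2 ≤ ‖f (a + (Complex.I * t) • 1)‖ ^ 2 := by
        have : (f a).im + t = (f (a + (Complex.I * t) • 1)).im := by simp [hf1]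
        rw [this, ← sq_abs]
        gcongr
        exact Complex.abs_im_le_norm _
      exact h3.trans ((by gcongr : _ ≤ ‖a + (Complex.I * t) • (1 : P)‖ ^ 2).trans h1)
    by_contra hne
    have h4 := h ((‖a‖ ^ 2 + 1) / (2 * (f a).im))
    have : 2 * (f a).im * ((‖a‖ ^ 2 + 1) / (2 * (f a).im)) = ‖a‖ ^ 2 + 1 := by field_simp
    nlinarith [sq_nonneg (f a).im]
  refine ⟨PositiveLinearMap.mk₀ f.toLinearMap fun a ha => ?_, hf1⟩
  change 0 ≤ f a
  have hsa : IsSelfAdjoint a := ha.isSelfAdjoint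
  refine Complex.nonneg_iff.2 ⟨?_, (him a hsa).symm⟩
  -- From 0 ≤ a ≤ ‖a‖, the bound ‖a‖ - Re f(a) ≤ ‖a‖ follows.
  have h1 : ‖algebraMap ℝ P ‖a‖ - a‖ ≤ ‖a‖ := by
    have hb : 0 ≤ algebraMap ℝ P ‖a‖ - a := sub_nonneg.2 hsa.le_algebraMap_norm_self
    refine (CStarAlgebra.norm_le_iff_le_algebraMap _ (norm_nonneg a) hb).2 ?_
    exact sub_le_self _ ha
  have h2 := (Complex.re_le_norm _).trans ((hle (algebraMap ℝ P ‖a‖ - a)).trans h1)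
  rw [map_sub, Algebra.algebraMap_eq_smul_one, ← Complex.coe_smul, map_smul, hf1] at h2
  simpa using h2

theorem exists_rep_one_ne_zero.{u} (P : Type u) [CStarAlgebra P] [Nontrivial P] :
    ∃ (𝓗 : Type u) (_ : NormedAddCommGroup 𝓗) (_ : InnerProductSpace ℂ 𝓗) (_ : CompleteSpace 𝓗)
      (ρ : P →⋆ₐ[ℂ] (𝓗 →L[ℂ] 𝓗)), ρ 1 ≠ 0 := by
  let _ := CStarAlgebra.spectralOrder P
  let _ := CStarAlgebra.spectralOrderedRing P
  obtain ⟨f, hf⟩ := exists_state P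
  refine ⟨f.GNS, inferInstance, inferInstance, inferInstance, f.gnsStarAlgHom, fun h => ?_⟩
  rw [map_one] at h
  -- The cyclic vector has squared norm f(1) = 1, so the unit cannot act as zero.
  have h1 : ((f.toPreGNS 1 : f.PreGNS) : f.GNS) = 0 := by
    simpa using congrArg (fun T : f.GNS →L[ℂ] f.GNS => T (f.toPreGNS 1 : f.PreGNS)) h
  have h2 := f.preGNS_norm_sq (f.toPreGNS 1)
  rw [← UniformSpace.Completion.norm_coe, h1] at h2
  simp [hf] at h2

end State

/-! ### Norm estimates for crossed products -/

namespace CrossedKind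

universe u v w

variable {P : Type u} [CStarAlgebra P] (κ : CrossedKind.{u, w} P) {G : Type v} [Group G]
  [MulSemiringAction G P] [StarAction G P]

/-- Beyond this point the kind of crossed product enters only through this bound, `norm_ccIncl` and
`norm_one_ne_zero`. -/
theorem norm_ccRestrict_le (M : Subgroup G) [M.FiniteIndex] (x : SkewMonoidAlgebra P G) :
    (κ.norm M).toSeminorm (ccRestrict M x) ≤ (κ.norm G).toSeminorm x := by
  cases κ with
  | universal => exact universalNorm_ccRestrict_le M x
  | reduced 𝓗 ρ hρ => exact norm_regularRep_ccRestrict_le ρ M x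

theorem norm_ccIncl (M : Subgroup G) [M.FiniteIndex] (y : SkewMonoidAlgebra P M) :
    (κ.norm G).toSeminorm (ccIncl M y) = (κ.norm M).toSeminorm y := by
  cases κ with
  | universal => exact universalNorm_ccIncl M y
  | reduced 𝓗 ρ hρ => exact norm_regularRep_ccIncl hρ M y

theorem norm_one_ne_zero [Nontrivial P] : (κ.norm G).toSeminorm 1 ≠ 0 := by
  cases κ with
  | universal =>
    obtain ⟨𝓗, _, _, _, ρ, hρ⟩ := exists_rep_one_ne_zero P
    have h := (norm_rep_coeff_le ρ (1 : SkewMonoidAlgebra P G) 1).trans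
      (norm_rep_le_sSup (regularRep ρ))
    rw [coeff_one, Finsupp.single_eq_same, smul_one] at h
    exact ((norm_pos_iff.2 hρ).trans_le h).ne'
  | reduced 𝓗 ρ hρ =>
    have h := norm_coeff_le_norm_regularRep hρ (1 : SkewMonoidAlgebra P G) 1
    rw [coeff_one, Finsupp.single_eq_same] at h
    exact ((norm_pos_iff.2 one_ne_zero).trans_le h).ne'

instance [Nontrivial P] : Nontrivial (κ.Product G) :=
  ⟨1, 0, fun h => κ.norm_one_ne_zero (G := G) (by
    rw [← CStarSeminorm.norm_toCompl, map_one, h, norm_zero])⟩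

end CrossedKind

/-! ### Generalities on conditional expectations of finite index -/

section Watatani

variable {A : Type*} [CStarAlgebra A] {B C : StarSubalgebra ℂ A} {E F F' : A →ₗ[ℂ] A}

theorem eq_zero_of_forall_mul_left (hf : HasFiniteIndex E) {z : A} (h : ∀ y, E (y * z) = 0) :
    z = 0 := by
  obtain ⟨n, l, hl⟩ := hf
  rw [(hl z).2]
  simp [h]

/-- The compatible conditional expectation onto an intermediate subalgebra is unique. -/
theorem IsCompatibleExp.unique (hf : HasFiniteIndex E) (h : IsCompatibleExp E C F)
    (h' : IsCompatibleExp E C F') : F = F' := by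
  ext x
  rw [← sub_eq_zero]
  refine eq_zero_of_forall_mul_left hf fun y => ?_
  -- Because this difference lies in C, pairing it with y under E is the same as pairing it with
  -- F(y), and both F(x) and F'(x) then pair like x.
  have hm : F x - F' x ∈ C := sub_mem (h.1.mem x) (h'.1.mem x)
  have h1 : E (F y * F x) = E (F y * x) := by
    rw [← h.1.map_mul_left _ (h.1.mem y), h.2]
  have h2 : E (F y * F' x) = E (F y * x) := by
    rw [← h'.1.map_mul_left _ (h.1.mem y), h'.2]
  rw [← h.2, h.1.map_mul_right _ hm, mul_sub, map_sub, h1, h2, sub_self]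

/-- Both sides equal E(F(x)^* F(y)). Compatibility with the involution is a separate hypothesis
because `IsCondExp` does not record it. -/
theorem IsCompatibleExp.isAdjointFor (h : IsCompatibleExp E C F)
    (hs : ∀ x, F (star x) = star (F x)) : IsAdjointFor E F F := fun x y => by
  rw [← h.2, ← hs, h.1.map_mul_left _ (h.1.mem _), ← h.1.map_mul_right _ (h.1.mem _), h.2]

theorem IsAdjointFor.sub {S S' T T' : Module.End ℂ A} (h : IsAdjointFor E T S)
    (h' : IsAdjointFor E T' S') : IsAdjointFor E (T - T') (S - S') := fun x y => by
  simp only [LinearMap.sub_apply, star_sub, sub_mul, mul_sub, map_sub]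
  rw [h, h']

/-- The dual conditional expectation can be computed from any quasi-basis. -/
theorem dualExp_eq (hE : IsCondExp B E) {n : ℕ} {l : Fin n → A} (hl : IsQuasiBasis E l)
    {T : Module.End ℂ A} (hT : ∀ a, ∀ b ∈ B, T (a * b) = T a * b) :
    dualExp E T = Ring.inverse (watataniIndex E) * ∑ i, T (l i) * star (l i) := by
  -- Right B-linearity writes T as ∑ T(l_i) e_B l_i^*, where `dualExp_apply` applies termwise.
  have h : T = ∑ i, LinearMap.mulLeft ℂ (T (l i)) * jonesProjection E *
      LinearMap.mulLeft ℂ (star (l i)) := by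
    ext x
    conv_lhs => rw [(hl x).2]
    simp [jonesProjection, hT _ _ (hE.mem _)]
  conv_lhs => rw [h]
  rw [_root_.map_sum, Finset.mul_sum]
  exact Finset.sum_congr rfl fun i _ => dualExp_apply ⟨n, l, hl⟩ _ _

end Watatani

/-! ### Counting cosets -/

/-- Excludes the default value 0 of `relIndex`, so every relative index of H below is a true count
and at least 1. -/
theorem relIndex_ne_zero_of_finiteIndex {G : Type*} [Group G] (H N : Subgroup G)
    [H.FiniteIndex] : H.relIndex N ≠ 0 :=
  (inferInstance : (H.subgroupOf N).FiniteIndex).index_ne_zero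

/-- Since H ≤ N, the subgroup N is a union of left cosets of H, so the test does not depend on the
representative. -/
theorem card_filter_out_mem {G : Type*} [Group G] {H N : Subgroup G} (hHN : H ≤ N)
    [Fintype (G ⧸ H)] [DecidablePred fun q : G ⧸ H => q.out ∈ N] :
    (Finset.univ.filter fun q : G ⧸ H => q.out ∈ N).card = H.relIndex N := by
  have hout : ∀ g : G, (g : G ⧸ H).out ∈ N ↔ g ∈ N := fun g => by
    have h : g⁻¹ * (g : G ⧸ H).out ∈ N := hHN (by rw [← QuotientGroup.eq]; simp)
    refine ⟨fun h1 => ?_, fun h1 => ?_⟩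
    · simpa using N.mul_mem h1 (N.inv_mem h)
    · simpa using N.mul_mem h1 h
  rw [Subgroup.relIndex, Subgroup.index, ← Fintype.card_subtype, ← Nat.card_eq_fintype_card]
  let f : N ⧸ H.subgroupOf N → {q : G ⧸ H // q.out ∈ N} :=
    Quotient.lift (fun n : N => ⟨((n : G) : G ⧸ H), (hout n).2 n.2⟩) fun a b hab => by
      have := QuotientGroup.leftRel_apply.1 hab
      exact Subtype.ext (QuotientGroup.eq.2 (by simpa [Subgroup.mem_subgroupOf] using this))
  refine (Nat.card_congr (Equiv.ofBijective f ⟨?_, ?_⟩)).symm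
  · intro a b
    induction a using QuotientGroup.induction_on
    induction b using QuotientGroup.induction_on
    intro hab
    have := QuotientGroup.eq.1 (congrArg Subtype.val hab)
    exact QuotientGroup.eq.2 (by simpa [Subgroup.mem_subgroupOf] using this)
  · rintro ⟨q, hq⟩
    exact ⟨((⟨q.out, hq⟩ : N) : N ⧸ H.subgroupOf N), Subtype.ext (by
      change ((q.out : G) : G ⧸ H) = q
      simp)⟩

/-! ### Embeddings and conditional expectations of crossed products -/

namespace CrossedKind

universe u v w

variable {P : Type u} [CStarAlgebra P] (κ : CrossedKind.{u, w} P) {G : Type v} [Group G]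
  [MulSemiringAction G P] [StarAction G P] (M N : Subgroup G)

/-- The canonical embedding of the crossed product by a subgroup of finite index. -/
def embedding [M.FiniteIndex] : κ.Product M →⋆ₐ[ℂ] κ.Product G :=
  (κ.norm M).lift ((κ.of G).comp (ccInclHom M)) fun y =>
    ((CStarSeminorm.norm_toCompl _ _).trans (κ.norm_ccIncl M y)).le

theorem embedding_of [M.FiniteIndex] (y : SkewMonoidAlgebra P M) :
    κ.embedding M (κ.of M y) = κ.of G (ccIncl M y) :=
  (κ.norm M).lift_toCompl (f := (κ.of G).comp (ccInclHom M)) _ y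

theorem norm_embedding [M.FiniteIndex] (z : κ.Product M) : ‖κ.embedding M z‖ = ‖z‖ := by
  have := (κ.embedding M).continuous_of_cstarAlgebra
  induction z using (κ.norm M).isClosed_induction with
  | hc => exact isClosed_eq this.norm continuous_norm
  | h y =>
    rw [embedding_of, CStarSeminorm.norm_toCompl, CStarSeminorm.norm_toCompl, norm_ccIncl]

theorem isEmbedding_embedding [M.FiniteIndex] : κ.IsEmbedding M (κ.embedding M) :=
  ⟨(AddMonoidHomClass.isometry_of_norm _ (κ.norm_embedding M)).injective, κ.embedding_of M⟩

theorem isClosed_range_embedding [M.FiniteIndex] :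
    IsClosed ((κ.embedding M).range : Set (κ.Product G)) := by
  have h : ((κ.embedding M).range : Set (κ.Product G)) = Set.range (κ.embedding M) := by
    ext a; rfl
  rw [h]
  exact (AddMonoidHomClass.isometry_of_norm _
    (κ.norm_embedding M)).isClosedEmbedding.isClosed_range

/-- The extension of `∑ a_g g ↦ ∑_{m ∈ M} a_m m` to the crossed product. -/
def condExp : κ.Product G →L[ℂ] κ.Product G :=
  (κ.norm G).liftL ((κ.of G).toAlgHom.toLinearMap ∘ₗ ccProj M)

theorem condExp_of [M.FiniteIndex] (x : SkewMonoidAlgebra P G) :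
    κ.condExp M (κ.of G x) = κ.of G (ccProj M x) :=
  (κ.norm G).liftL_toCompl (f := (κ.of G).toAlgHom.toLinearMap ∘ₗ ccProj M)
    (fun x => ((CStarSeminorm.norm_toCompl _ _).trans (κ.norm_ccIncl M _)).le.trans
      (κ.norm_ccRestrict_le M x)) x

theorem condExp_of_single_of_mem [M.FiniteIndex] {g : G} (hg : g ∈ M) (a : P) :
    κ.condExp M (κ.of G (single g a)) = κ.of G (single g a) := by
  rw [condExp_of, ccProj_single_of_mem M hg]

theorem condExp_of_single_of_notMem [M.FiniteIndex] {g : G} (hg : g ∉ M) (a : P) :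
    κ.condExp M (κ.of G (single g a)) = 0 := by
  rw [condExp_of, ccProj_single_of_notMem M hg, map_zero]

theorem condExp_embedding [M.FiniteIndex] (z : κ.Product M) :
    κ.condExp M (κ.embedding M z) = κ.embedding M z := by
  have := (κ.embedding M).continuous_of_cstarAlgebra
  induction z using (κ.norm M).isClosed_induction with
  | hc => exact isClosed_eq ((κ.condExp M).continuous.comp this) this
  | h y => rw [embedding_of, condExp_of, ccProj_ccIncl]

theorem condExp_mem_range [M.FiniteIndex] (a : κ.Product G) :
    κ.condExp M a ∈ (κ.embedding M).range := by
  induction a using (κ.norm G).isClosed_induction with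
  | hc => exact (κ.isClosed_range_embedding M).preimage (κ.condExp M).continuous
  | h x => exact ⟨κ.of M (ccRestrict M x), by
      rw [condExp_of, ccProj_apply]; exact κ.embedding_of M _⟩

/-- Turns inclusions between the subalgebras into identities between the projections. -/
theorem mem_range_embedding [M.FiniteIndex] {a : κ.Product G} :
    a ∈ (κ.embedding M).range ↔ κ.condExp M a = a := by
  refine ⟨?_, fun h => h ▸ κ.condExp_mem_range M a⟩
  rintro ⟨z, rfl⟩
  exact κ.condExp_embedding M z

theorem condExp_star [M.FiniteIndex] (a : κ.Product G) :
    κ.condExp M (star a) = star (κ.condExp M a) := by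
  have := (κ.condExp M).continuous
  induction a using (κ.norm G).isClosed_induction with
  | hc => exact isClosed_eq (this.comp continuous_star) (continuous_star.comp this)
  | h x => rw [← map_star, condExp_of, condExp_of, ccProj_star, map_star]

theorem condExp_condExp [M.FiniteIndex] [N.FiniteIndex] (a : κ.Product G) :
    κ.condExp M (κ.condExp N a) = κ.condExp (M ⊓ N) a := by
  induction a using (κ.norm G).isClosed_induction with
  | hc => exact isClosed_eq (by fun_prop) (by fun_prop)
  | h x => rw [condExp_of, condExp_of, condExp_of, ccProj_ccProj]

theorem condExp_mul_left [M.FiniteIndex] {b : κ.Product G} (hb : b ∈ (κ.embedding M).range)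
    (a : κ.Product G) : κ.condExp M (b * a) = b * κ.condExp M a := by
  obtain ⟨z, rfl⟩ := hb
  change κ.condExp M (κ.embedding M z * a) = κ.embedding M z * κ.condExp M a
  have h1 := (κ.embedding M).continuous_of_cstarAlgebra
  have h2 := (κ.condExp M).continuous
  induction z using (κ.norm M).isClosed_induction with
  | hc => exact isClosed_eq (h2.comp (h1.mul continuous_const)) (h1.mul continuous_const)
  | h y =>
    induction a using (κ.norm G).isClosed_induction with
    | hc => exact isClosed_eq (h2.comp (continuous_const.mul continuous_id))
              (continuous_const.mul h2)
    | h x => rw [embedding_of, ← map_mul, condExp_of, condExp_of, ccProj_ccIncl_mul, map_mul]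

theorem condExp_mul_right [M.FiniteIndex] {b : κ.Product G} (hb : b ∈ (κ.embedding M).range)
    (a : κ.Product G) : κ.condExp M (a * b) = κ.condExp M a * b := by
  have h := congrArg star (κ.condExp_mul_left M (star_mem hb) (star a))
  rwa [← star_mul, condExp_star, star_star, condExp_star, ← star_mul, star_star] at h

/-- The element of the crossed product given by a representative of a left coset of `M`. -/
def cosetUnitary (q : G ⧸ M) : κ.Product G := κ.of G (cosetElt P M q)

theorem cosetUnitary_mul_star (q : G ⧸ M) :
    κ.cosetUnitary M q * star (κ.cosetUnitary M q) = 1 := by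
  rw [cosetUnitary, ← map_star, ← map_mul, cosetElt_mul_star, map_one]

theorem sum_cosetUnitary_mul_condExp [M.FiniteIndex] [Fintype (G ⧸ M)] (a : κ.Product G) :
    ∑ q, κ.cosetUnitary M q * κ.condExp M (star (κ.cosetUnitary M q) * a) = a := by
  induction a using (κ.norm G).isClosed_induction with
  | hc => exact isClosed_eq (by fun_prop) (by fun_prop)
  | h x =>
    simp only [cosetUnitary, ← map_star, ← map_mul, condExp_of, ← _root_.map_sum]
    rw [sum_cosetElt_mul_ccProj]

theorem sum_condExp_mul_star_cosetUnitary [M.FiniteIndex] [Fintype (G ⧸ M)] (a : κ.Product G) :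
    ∑ q, κ.condExp M (a * κ.cosetUnitary M q) * star (κ.cosetUnitary M q) = a := by
  have h := congrArg star (κ.sum_cosetUnitary_mul_condExp M (star a))
  simpa only [star_sum, star_mul, star_star, ← condExp_star] using h

/-- A Parseval identity for the coset unitaries; with a = b it exhibits E(a^* a) as a sum of squares
and so gives positivity. -/
theorem condExp_star_mul [M.FiniteIndex] [Fintype (G ⧸ M)] (a b : κ.Product G) :
    κ.condExp M (star a * b) = ∑ q, star (κ.condExp M (star (κ.cosetUnitary M q) * a)) *
      κ.condExp M (star (κ.cosetUnitary M q) * b) := by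
  conv_lhs => rw [← κ.sum_cosetUnitary_mul_condExp M b]
  rw [Finset.mul_sum, _root_.map_sum]
  refine Finset.sum_congr rfl fun q _ => ?_
  rw [← mul_assoc, condExp_mul_right _ _ (κ.condExp_mem_range M _), ← condExp_star, star_mul,
    star_star]

theorem isCondExp_condExp [M.FiniteIndex] :
    IsCondExp (κ.embedding M).range (κ.condExp M : κ.Product G →ₗ[ℂ] κ.Product G) where
  mem := κ.condExp_mem_range M
  map_of_mem b hb := (κ.mem_range_embedding M).1 hb
  map_mul_left b hb := κ.condExp_mul_left M hb
  map_mul_right b hb := κ.condExp_mul_right M hb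
  positive a := by
    let _ := CStarAlgebra.spectralOrder (κ.Product G)
    let _ := CStarAlgebra.spectralOrderedRing (κ.Product G)
    let _ := Fintype.ofFinite (G ⧸ M)
    refine CStarAlgebra.nonneg_iff_eq_star_mul_self.1 ?_
    change 0 ≤ κ.condExp M (star a * a)
    rw [condExp_star_mul]
    exact Finset.sum_nonneg fun q _ => star_mul_self_nonneg _

/-- The coset representatives, enumerated. -/
def cosetBasis [M.FiniteIndex] (i : Fin M.index) : κ.Product G :=
  κ.cosetUnitary M ((Finite.equivFin (G ⧸ M)).symm i)

theorem isQuasiBasis_cosetBasis [M.FiniteIndex] :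
    IsQuasiBasis (κ.condExp M : κ.Product G →ₗ[ℂ] κ.Product G) (κ.cosetBasis M) := fun a => by
  let _ := Fintype.ofFinite (G ⧸ M)
  constructor
  · conv_lhs => rw [← κ.sum_condExp_mul_star_cosetUnitary M a]
    exact (Equiv.sum_comp (Finite.equivFin (G ⧸ M)).symm fun q =>
      κ.condExp M (a * κ.cosetUnitary M q) * star (κ.cosetUnitary M q)).symm
  · conv_lhs => rw [← κ.sum_cosetUnitary_mul_condExp M a]
    exact (Equiv.sum_comp (Finite.equivFin (G ⧸ M)).symm fun q =>
      κ.cosetUnitary M q * κ.condExp M (star (κ.cosetUnitary M q) * a)).symm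

theorem hasFiniteIndex_condExp [M.FiniteIndex] :
    HasFiniteIndex (κ.condExp M : κ.Product G →ₗ[ℂ] κ.Product G) :=
  ⟨_, _, κ.isQuasiBasis_cosetBasis M⟩

theorem watataniIndex_condExp [M.FiniteIndex] :
    watataniIndex (κ.condExp M : κ.Product G →ₗ[ℂ] κ.Product G) =
      algebraMap ℂ (κ.Product G) M.index := by
  rw [watataniIndex_eq (κ.isQuasiBasis_cosetBasis M)]
  simp [cosetBasis, cosetUnitary_mul_star]

/-! ### Intermediate crossed products and the interior angle -/

section Intermediate

variable {M N} {H K L : Subgroup G}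

theorem isCompatibleExp_condExp [H.FiniteIndex] [K.FiniteIndex] (hHK : H ≤ K) :
    IsCompatibleExp (κ.condExp H : κ.Product G →ₗ[ℂ] κ.Product G) (κ.embedding K).range
      (κ.condExp K : κ.Product G →ₗ[ℂ] κ.Product G) :=
  ⟨κ.isCondExp_condExp K, fun a => (κ.condExp_condExp H K a).trans (by
    rw [inf_eq_left.2 hHK]; rfl)⟩

theorem range_embedding_le [H.FiniteIndex] [K.FiniteIndex] (hHK : H ≤ K) :
    (κ.embedding H).range ≤ (κ.embedding K).range := fun a ha => by
  rw [mem_range_embedding] at ha ⊢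
  rw [← ha, condExp_condExp, inf_eq_right.2 hHK]

theorem range_embedding_mem_IMS [H.FiniteIndex] [K.FiniteIndex] (hHK : H ≤ K) :
    (κ.embedding K).range ∈ IMS (κ.embedding H).range
      (κ.condExp H : κ.Product G →ₗ[ℂ] κ.Product G) :=
  ⟨κ.isClosed_range_embedding K, κ.range_embedding_le hHK, _, κ.isCompatibleExp_condExp hHK⟩

/-- If g were outside M, the expectation would both fix and kill the unitary at g, which is
impossible in a nonzero algebra. -/
theorem mem_of_of_single_mem_range [Nontrivial P] [M.FiniteIndex] {g : G}
    (h : κ.of G (single g 1) ∈ (κ.embedding M).range) : g ∈ M := by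
  by_contra hg
  rw [mem_range_embedding, condExp_of_single_of_notMem _ _ hg] at h
  have h1 : κ.of G (single g⁻¹ 1) * κ.of G (single g 1) = 1 := by
    rw [← map_mul, single_mul_single, inv_mul_cancel, smul_one, mul_one, ← one_def, map_one]
  rw [← h, mul_zero] at h1
  exact zero_ne_one h1

theorem of_single_mem_range [M.FiniteIndex] {g : G} (hg : g ∈ M) :
    κ.of G (single g 1) ∈ (κ.embedding M).range := by
  rw [mem_range_embedding, condExp_of_single_of_mem _ _ hg]

theorem range_embedding_mem_diff [Nontrivial P] [H.FiniteIndex] [K.FiniteIndex] (hHK : H < K)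
    (hK : K < ⊤) :
    (κ.embedding K).range ∈ IMS (κ.embedding H).range
      (κ.condExp H : κ.Product G →ₗ[ℂ] κ.Product G) \ {⊤, (κ.embedding H).range} := by
  refine ⟨κ.range_embedding_mem_IMS hHK.le, ?_⟩
  rintro (h | h)
  · obtain ⟨g, -, hg⟩ := SetLike.exists_of_lt hK
    exact hg (κ.mem_of_of_single_mem_range (M := K) (h ▸ StarSubalgebra.mem_top))
  · obtain ⟨g, hgK, hg⟩ := SetLike.exists_of_lt hHK
    refine hg (κ.mem_of_of_single_mem_range (M := H) ?_)
    rw [← (h : (κ.embedding K).range = (κ.embedding H).range)]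
    exact κ.of_single_mem_range hgK

theorem dualExp_condExp [H.FiniteIndex] [K.FiniteIndex] (hHK : H ≤ K) :
    dualExp (κ.condExp H : κ.Product G →ₗ[ℂ] κ.Product G)
      (κ.condExp K : κ.Product G →ₗ[ℂ] κ.Product G) =
      algebraMap ℂ (κ.Product G) (H.relIndex K / H.index) := by
  classical
  let _ := Fintype.ofFinite (G ⧸ H)
  have hn : (H.index : ℂ) ≠ 0 := Nat.cast_ne_zero.2 H.index_ne_zero_of_finite
  rw [dualExp_eq (κ.isCondExp_condExp H) (κ.isQuasiBasis_cosetBasis H)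
    fun a b hb => κ.condExp_mul_right K (κ.range_embedding_le hHK hb) a]
  have h1 : ∑ i, (κ.condExp K : κ.Product G →ₗ[ℂ] κ.Product G) (κ.cosetBasis H i) *
      star (κ.cosetBasis H i) = algebraMap ℂ (κ.Product G) (H.relIndex K) := by
    refine (Equiv.sum_comp (Finite.equivFin (G ⧸ H)).symm fun q =>
      κ.condExp K (κ.cosetUnitary H q) * star (κ.cosetUnitary H q)).trans ?_
    -- Each coset of H inside K contributes u_q u_q^* = 1 and every other coset contributes 0, so
    -- the sum is [K:H].
    have h2 : ∀ q, κ.condExp K (κ.cosetUnitary H q) * star (κ.cosetUnitary H q) =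
        if q.out ∈ K then 1 else 0 := fun q => by
      split_ifs with hq
      · rw [← κ.cosetUnitary_mul_star H q]
        congr 1
        exact κ.condExp_of_single_of_mem K hq 1
      · rw [cosetUnitary, cosetElt, condExp_of_single_of_notMem _ _ hq, zero_mul]
    simp only [h2]
    rw [Finset.sum_boole, card_filter_out_mem hHK, map_natCast]
  have h3 : Ring.inverse (algebraMap ℂ (κ.Product G) H.index) =
      algebraMap ℂ (κ.Product G) (H.index : ℂ)⁻¹ := by
    have hu : IsUnit (algebraMap ℂ (κ.Product G) H.index) := (IsUnit.mk0 _ hn).map _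
    refine hu.mul_left_cancel ?_
    rw [Ring.mul_inverse_cancel _ hu, ← map_mul, mul_inv_cancel₀ hn, map_one]
  rw [h1, watataniIndex_condExp, h3, ← map_mul, div_eq_inv_mul]

theorem dualInner_condExp [H.FiniteIndex] [K.FiniteIndex] [L.FiniteIndex] (hHK : H ≤ K)
    (hHL : H ≤ L) :
    dualInner (κ.condExp H : κ.Product G →ₗ[ℂ] κ.Product G)
      (jonesProjection (κ.condExp K : κ.Product G →ₗ[ℂ] κ.Product G) -
        jonesProjection (κ.condExp H : κ.Product G →ₗ[ℂ] κ.Product G))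
      (jonesProjection (κ.condExp L : κ.Product G →ₗ[ℂ] κ.Product G) -
        jonesProjection (κ.condExp H : κ.Product G →ₗ[ℂ] κ.Product G)) =
      algebraMap ℂ (κ.Product G) (((H.relIndex (K ⊓ L) : ℝ) - 1) / H.index : ℝ) := by
  have hadj : IsAdjointFor (κ.condExp H : κ.Product G →ₗ[ℂ] κ.Product G)
      (jonesProjection (κ.condExp K : κ.Product G →ₗ[ℂ] κ.Product G) -
        jonesProjection (κ.condExp H : κ.Product G →ₗ[ℂ] κ.Product G))
      (jonesProjection (κ.condExp K : κ.Product G →ₗ[ℂ] κ.Product G) -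
        jonesProjection (κ.condExp H : κ.Product G →ₗ[ℂ] κ.Product G)) :=
    ((κ.isCompatibleExp_condExp hHK).isAdjointFor (κ.condExp_star K)).sub
    ((κ.isCompatibleExp_condExp le_rfl).isAdjointFor (κ.condExp_star H))
  have hprod : (jonesProjection (κ.condExp K : κ.Product G →ₗ[ℂ] κ.Product G) -
        jonesProjection (κ.condExp H : κ.Product G →ₗ[ℂ] κ.Product G)) *
      (jonesProjection (κ.condExp L : κ.Product G →ₗ[ℂ] κ.Product G) -
        jonesProjection (κ.condExp H : κ.Product G →ₗ[ℂ] κ.Product G)) =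
      (κ.condExp (K ⊓ L) : κ.Product G →ₗ[ℂ] κ.Product G) -
        (κ.condExp H : κ.Product G →ₗ[ℂ] κ.Product G) := by
    -- The mixed terms e_K e_H, e_H e_L and e_H e_H all equal e_H, since H lies in K and in L.
    ext a
    simp [jonesProjection, condExp_condExp, inf_eq_left.2 hHL, inf_eq_right.2 hHK]
  rw [dualInner, moduleAdjoint_eq (κ.hasFiniteIndex_condExp H) hadj]
  refine (congrArg _ hprod).trans ?_
  rw [map_sub, dualExp_condExp _ (le_inf hHK hHL), dualExp_condExp _ le_rfl, ← map_sub,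
    Subgroup.relIndex_self]
  congr 1
  push_cast
  rw [sub_div]

theorem norm_dualInner_condExp [Nontrivial P] [H.FiniteIndex] [K.FiniteIndex] [L.FiniteIndex]
    (hHK : H ≤ K) (hHL : H ≤ L) :
    ‖dualInner (κ.condExp H : κ.Product G →ₗ[ℂ] κ.Product G)
      (jonesProjection (κ.condExp K : κ.Product G →ₗ[ℂ] κ.Product G) -
        jonesProjection (κ.condExp H : κ.Product G →ₗ[ℂ] κ.Product G))
      (jonesProjection (κ.condExp L : κ.Product G →ₗ[ℂ] κ.Product G) -
        jonesProjection (κ.condExp H : κ.Product G →ₗ[ℂ] κ.Product G))‖ =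
      ((H.relIndex (K ⊓ L) : ℝ) - 1) / H.index := by
  rw [κ.dualInner_condExp hHK hHL, norm_algebraMap', Complex.norm_real, Real.norm_of_nonneg]
  have : (1 : ℝ) ≤ H.relIndex (K ⊓ L) := by
    exact_mod_cast Nat.one_le_iff_ne_zero.2 (relIndex_ne_zero_of_finiteIndex H (K ⊓ L))
  exact div_nonneg (by linarith) (Nat.cast_nonneg _)

theorem isInteriorAngle_iff [Nontrivial P] [H.FiniteIndex] [K.FiniteIndex] [L.FiniteIndex]
    (hHK : H < K) (hK : K < ⊤) (hHL : H < L) (hL : L < ⊤) {θ : ℝ} :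
    IsInteriorAngle (κ.embedding H).range (κ.condExp H : κ.Product G →ₗ[ℂ] κ.Product G)
      (κ.embedding K).range (κ.embedding L).range θ ↔ θ ∈ Set.Icc 0 (Real.pi / 2) ∧
        Real.cos θ = ((H.relIndex (K ⊓ L) : ℝ) - 1) /
          (√((H.relIndex K : ℝ) - 1) * √((H.relIndex L : ℝ) - 1)) := by
  have hK' := κ.range_embedding_mem_diff hHK hK
  have hL' := κ.range_embedding_mem_diff hHL hL
  have hn : 0 < (H.index : ℝ) := Nat.cast_pos.2 (Nat.pos_of_ne_zero H.index_ne_zero_of_finite)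
  have hcos : ((H.relIndex (K ⊓ L) : ℝ) - 1) / H.index /
      (√(((H.relIndex K : ℝ) - 1) / H.index) * √(((H.relIndex L : ℝ) - 1) / H.index)) =
      ((H.relIndex (K ⊓ L) : ℝ) - 1) /
          (√((H.relIndex K : ℝ) - 1) * √((H.relIndex L : ℝ) - 1)) := by
    rw [Real.sqrt_div' _ hn.le, Real.sqrt_div' _ hn.le, div_mul_div_comm,
      Real.mul_self_sqrt hn.le, div_div_div_cancel_right₀ hn.ne']
  have hKK := κ.norm_dualInner_condExp hHK.le hHK.le
  have hLL := κ.norm_dualInner_condExp hHL.le hHL.le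
  -- The denominators are the case K = L of the inner product.
  rw [inf_idem] at hKK hLL
  constructor
  · rintro ⟨-, -, hθ, F, F', hF, hF', h⟩
    -- The angle only asks for some compatible expectations; uniqueness identifies them with those
    -- of the subgroups.
    obtain rfl := hF.unique (κ.hasFiniteIndex_condExp H) (κ.isCompatibleExp_condExp hHK.le)
    obtain rfl := hF'.unique (κ.hasFiniteIndex_condExp H) (κ.isCompatibleExp_condExp hHL.le)
    refine ⟨hθ, h.trans ?_⟩
    rw [dualNorm, dualNorm, κ.norm_dualInner_condExp hHK.le hHL.le, hKK, hLL, hcos]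
  · rintro ⟨hθ, h⟩
    refine ⟨⟨hK'.1, fun h => hK'.2 (Or.inr h)⟩, ⟨hL'.1, fun h => hL'.2 (Or.inr h)⟩, hθ, _, _,
      κ.isCompatibleExp_condExp hHK.le, κ.isCompatibleExp_condExp hHL.le, h.trans ?_⟩
    rw [dualNorm, dualNorm, κ.norm_dualInner_condExp hHK.le hHL.le, hKK, hLL, hcos]

end Intermediate

end CrossedKind

theorem relIndex_angle_mem_Icc {G : Type*} [Group G] (H K L : Subgroup G) [H.FiniteIndex] :
    ((H.relIndex (K ⊓ L) : ℝ) - 1) /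
      (√((H.relIndex K : ℝ) - 1) * √((H.relIndex L : ℝ) - 1)) ∈ Set.Icc (0 : ℝ) 1 := by
  have h1 : (1 : ℝ) ≤ H.relIndex (K ⊓ L) := by
    exact_mod_cast Nat.one_le_iff_ne_zero.2 (relIndex_ne_zero_of_finiteIndex H (K ⊓ L))
  have h2 : (H.relIndex (K ⊓ L) : ℝ) ≤ H.relIndex K := by
    exact_mod_cast Subgroup.relIndex_le_of_le_right inf_le_left
      (relIndex_ne_zero_of_finiteIndex H K)
  have h3 : (H.relIndex (K ⊓ L) : ℝ) ≤ H.relIndex L := by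
    exact_mod_cast Subgroup.relIndex_le_of_le_right inf_le_right
      (relIndex_ne_zero_of_finiteIndex H L)
  refine ⟨div_nonneg (by linarith) (by positivity), div_le_one_of_le₀ ?_ (by positivity)⟩
  -- Writing the numerator a as √a · √a, each factor is bounded by one of the roots below.
  rw [← Real.mul_self_sqrt (by linarith : 0 ≤ (H.relIndex (K ⊓ L) : ℝ) - 1)]
  gcongr

end

theorem mainTheorem3 {G : Type*} [Group G] {P : Type*} [CStarAlgebra P] [Nontrivial P]
    [MulSemiringAction G P] [StarAction G P] (κ : CrossedKind P)
    (H K L : Subgroup G) [H.FiniteIndex] (hHK : H < K) (hKG : K < ⊤) (hHL : H < L) (hLG : L < ⊤) :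
    ∃ (jH : κ.Product H →⋆ₐ[ℂ] κ.Product G) (jK : κ.Product K →⋆ₐ[ℂ] κ.Product G)
      (jL : κ.Product L →⋆ₐ[ℂ] κ.Product G) (E : κ.Product G →ₗ[ℂ] κ.Product G),
      κ.IsEmbedding H jH ∧ κ.IsEmbedding K jK ∧ κ.IsEmbedding L jL ∧
      (∀ x : SkewMonoidAlgebra P G, E (κ.of G x) = jH (κ.of H (ccRestrict H x))) ∧
      IsCondExp jH.range E ∧ HasFiniteIndex E ∧
      jK.range ∈ IMS jH.range E \ {⊤, jH.range} ∧
      jL.range ∈ IMS jH.range E \ {⊤, jH.range} ∧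
      (∃! θ : ℝ, IsInteriorAngle jH.range E jK.range jL.range θ) ∧
      ∀ θ : ℝ, IsInteriorAngle jH.range E jK.range jL.range θ →
        Real.cos θ = ((H.relIndex (K ⊓ L) : ℝ) - 1) /
          (√((H.relIndex K : ℝ) - 1) * √((H.relIndex L : ℝ) - 1)) := by
  have hKf : K.FiniteIndex := Subgroup.finiteIndex_of_le hHK.le
  have hLf : L.FiniteIndex := Subgroup.finiteIndex_of_le hHL.le
  refine ⟨κ.embedding H, κ.embedding K, κ.embedding L, κ.condExp H, κ.isEmbedding_embedding H,
    κ.isEmbedding_embedding K, κ.isEmbedding_embedding L,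
    fun x => (κ.condExp_of H x).trans (κ.embedding_of H _).symm, κ.isCondExp_condExp H,
    κ.hasFiniteIndex_condExp H, κ.range_embedding_mem_diff hHK hKG,
    κ.range_embedding_mem_diff hHL hLG, ?_,
    fun θ hθ => ((κ.isInteriorAngle_iff hHK hKG hHL hLG).1 hθ).2⟩
  simp only [κ.isInteriorAngle_iff hHK hKG hHL hLG]
  have hc := relIndex_angle_mem_Icc H K L
  refine ⟨Real.arccos _, ⟨⟨Real.arccos_nonneg _, Real.arccos_le_pi_div_two.2 hc.1⟩,
    Real.cos_arccos (by linarith [hc.1]) hc.2⟩, fun θ hθ => ?_⟩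
  have := Real.pi_pos
  -- Uniqueness of the angle holds because arccos inverts cos on [0, π/2].
  rw [← hθ.2, Real.arccos_cos hθ.1.1 (by linarith [hθ.1.2])]
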